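/- Let concept names, role names, feature names and individual names form four disjoint countably infinite sets. Names are written as binary words. Each feature name $f$ has a totally ordered domain $\mathrm{dom}(f)$; distinct values that may occur in an input are written as distinct binary words. The concepts of $\mathcal{ALCQI}(f)$ are given by $$C,D ::= \top \mid A \mid \neg C \mid C\sqcap D \mid (\bowtie n\ R.C) \mid (f\bowtie v),$$ where $A$ is a concept name, ${\bowtie}\in\{\le,\ge\}$, $n\ge 0$ is an integer, $R$ is a role name $r$ or an inverse role $r^-$, $f$ is a feature name and $v\in\mathrm{dom}(f)$. In $\mathcal{ALCQ}(f)$ inverse roles are not allowed, in $\mathcal{ALCQI}$ feature comparisons $(f\bowtie v)$ are not allowed, and in $\mathcal{ALCQ}$ neither is allowed. A database $I$ is a finite set of facts $A(a)$, $r(a,b)$, $f(a,v)$ with $a,b$ individual names and $v\in\mathrm{dom}(f)$, which for all $f,a$ contains at most one fact $f(a,v)$; $\mathrm{adom}(I)$ is the set of individual names that occur in $I$. For a role $R$ let $\mathrm{succ}^{R}_I(a)=\{b\mid R(a,b)\in I\}$, where $r^-(a,b)\in I$ means $r(b,a)\in I$. The extension $C^I$ is defined by $\top^I=\mathrm{adom}(I)$,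 $A^I=\{a\mid A(a)\in I\}$, $(\neg C)^I=\mathrm{adom}(I)\setminus C^I$, $(C\sqcap D)^I=C^I\cap D^I$, $(\bowtie n\ R.C)^I=\{a\in\mathrm{adom}(I) : |\mathrm{succ}^R_I(a)\cap C^I|\bowtie n\}$, and $(f\bowtie v)^I=\{a\in\mathrm{adom}(I) : f(a,v')\in I \text{ for some } v' \text{ with } v'\bowtie v\}$. For $\mathcal L\in\{\mathcal{ALCQI}(f),\mathcal{ALCQ}(f),\mathcal{ALCQI},\mathcal{ALCQ}\}$, the fitting problem for $\mathcal L$ is: given a database $I$ and sets $P,N\subseteq\mathrm{adom}(I)$ (as lists of their elements), decide whether there is an $\mathcal L$ concept $C$ with $a\in C^I$ for all $a\in P$ and $b\notin C^I$ for all $b\in N$. **Theorem.** The fitting problem for each of $\mathcal{ALCQI}(f)$, $\mathcal{ALCQ}(f)$, $\mathcal{ALCQI}$ and $\mathcal{ALCQ}$ is decidable in polynomial time: there is a (multi-tape) Turing machine that decides it and whose number of steps is bounded by a polynomial in the length of the input word. -/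

import Mathlib

namespace DL

/-! ### Names and feature domains -/

/-- Names are finite binary words. The four sorts of names below are told apart by the position
in which they are used (a name is always the argument of a constructor that fixes its sort), so
they behave as four disjoint countably infinite sets. -/
abbrev Name : Type := List Bool

abbrev ConceptName : Type := Name
abbrev RoleName : Type := Name
abbrev FeatureName : Type := Name
abbrev IndName : Type := Name

/-- Every feature name `f` has a totally ordered domain `dom f`. To be part of the input of an
algorithm a value has to be written down: `writable f` is the set of the values that have a
finite representation (all of `dom f`, or for example the rationals in `dom f = ℝ`), and `code f v`
is the binary word for such a value `v`. Different values have different words. Nothing is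
assumed on the complexity of the order or of the set of words. -/
structure FeatureDomains where
  dom : FeatureName → Type
  [linearOrder : ∀ f, LinearOrder (dom f)]
  writable : ∀ f, Set (dom f)
  code : ∀ f, dom f → List Bool
  code_injOn : ∀ f, Set.InjOn (code f) (writable f)

attribute [instance] FeatureDomains.linearOrder

/-! ### Concepts -/

/-- The comparison symbols `≤` and `≥`. -/
inductive Cmp where
  | le
  | ge

/-- `c.Holds x y` is `x ≤ y` or `x ≥ y`. -/
def Cmp.Holds {α : Type} [LE α] : Cmp → α → α → Prop
  | .le, x, y => x ≤ y
  | .ge, x, y => x ≥ y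

/-- A role is a role name `r` or an inverse role `r⁻`. -/
inductive Role where
  | name (r : RoleName)
  | inv (r : RoleName)

/-- `ALCQI(f)` concepts. -/
inductive Concept (𝔻 : FeatureDomains) where
  /-- the concept `⊤` -/
  | top
  /-- a concept name `A` -/
  | atom (A : ConceptName)
  /-- the negation `¬ C` -/
  | neg (C : Concept 𝔻)
  /-- the conjunction `C ⊓ D` -/
  | inter (C D : Concept 𝔻)
  /-- the qualified number restriction `(⋈ n R.C)` -/
  | number (c : Cmp) (n : ℕ) (R : Role) (C : Concept 𝔻)
  /-- the feature comparison `(f ⋈ v)` -/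
  | feature (f : FeatureName) (c : Cmp) (v : 𝔻.dom f)

/-- No inverse role occurs in the concept. -/
def Concept.InverseFree {𝔻 : FeatureDomains} : Concept 𝔻 → Prop
  | .top => True
  | .atom _ => True
  | .neg C => C.InverseFree
  | .inter C D => C.InverseFree ∧ D.InverseFree
  | .number _ _ (.name _) C => C.InverseFree
  | .number _ _ (.inv _) _ => False
  | .feature _ _ _ => True

/-- No feature comparison occurs in the concept. -/
def Concept.FeatureFree {𝔻 : FeatureDomains} : Concept 𝔻 → Prop
  | .top => True
  | .atom _ => True
  | .neg C => C.FeatureFree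
  | .inter C D => C.FeatureFree ∧ D.FeatureFree
  | .number _ _ _ C => C.FeatureFree
  | .feature _ _ _ => False

/-- The description logic `ALCQI(f)`, as its set of concepts. -/
def ALCQIf (𝔻 : FeatureDomains) : Set (Concept 𝔻) := Set.univ

/-- `ALCQ(f)`: no inverse roles. -/
def ALCQf (𝔻 : FeatureDomains) : Set (Concept 𝔻) := {C | C.InverseFree}

/-- `ALCQI`: no feature comparisons. -/
def ALCQI (𝔻 : FeatureDomains) : Set (Concept 𝔻) := {C | C.FeatureFree}

/-- `ALCQ`: neither inverse roles nor feature comparisons. -/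
def ALCQ (𝔻 : FeatureDomains) : Set (Concept 𝔻) := {C | C.InverseFree ∧ C.FeatureFree}

/-! ### Databases and semantics -/

/-- Facts `A(a)`, `r(a,b)` and `f(a,v)`. -/
inductive DBFact (𝔻 : FeatureDomains) where
  | concept (A : ConceptName) (a : IndName)
  | role (r : RoleName) (a b : IndName)
  | feature (f : FeatureName) (a : IndName) (v : 𝔻.dom f)

/-- The individual names that occur in a fact. -/
def DBFact.inds {𝔻 : FeatureDomains} : DBFact 𝔻 → Set IndName
  | .concept _ a => {a}
  | .role _ a b => {a, b}
  | .feature _ a _ => {a}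

/-- A database: a finite set of facts with at most one fact `f(a,v)` for all `f` and `a`. -/
structure Database (𝔻 : FeatureDomains) where
  facts : Finset (DBFact 𝔻)
  functional : ∀ (f : FeatureName) (a : IndName) (v v' : 𝔻.dom f),
    DBFact.feature f a v ∈ facts → DBFact.feature f a v' ∈ facts → v = v'

namespace Database

variable {𝔻 : FeatureDomains}

/-- The set of all individual names that occur in the database. -/
def adom (I : Database 𝔻) : Set IndName := {a | ∃ φ ∈ I.facts, a ∈ φ.inds}

/-- The successors of `a` along a role. -/
def succ (I : Database 𝔻) : Role → IndName → Set IndName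
  | .name r, a => {b | DBFact.role r a b ∈ I.facts}
  | .inv r, a => {b | DBFact.role r b a ∈ I.facts}

/-- The extension of a concept in a database. The sets that are counted here are finite. -/
def ext (I : Database 𝔻) : Concept 𝔻 → Set IndName
  | .top => I.adom
  | .atom A => {a | DBFact.concept A a ∈ I.facts}
  | .neg C => I.adom \ I.ext C
  | .inter C D => I.ext C ∩ I.ext D
  | .number c n R C => {a | a ∈ I.adom ∧ c.Holds (I.succ R a ∩ I.ext C).ncard n}
  | .feature f c v => {a | a ∈ I.adom ∧ ∃ v', DBFact.feature f a v' ∈ I.facts ∧ c.Holds v' v}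

end Database

/-! ### The fitting problem -/

/-- The concept `C` fits the positive examples `P` and the negative examples `N` in `I`. -/
def Fits {𝔻 : FeatureDomains} (I : Database 𝔻) (P N : Finset IndName) (C : Concept 𝔻) : Prop :=
  (∀ a ∈ P, a ∈ I.ext C) ∧ ∀ b ∈ N, b ∉ I.ext C

/-- An input of the fitting problem: a database `I` and sets `P`, `N` of individuals of `I`,
presented by lists (in any order, possibly with repetitions) of their elements. -/
structure FittingInput (𝔻 : FeatureDomains) where
  I : Database 𝔻
  P : Finset IndName
  N : Finset IndName
  P_subset : ∀ a ∈ P, a ∈ I.adom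
  N_subset : ∀ a ∈ N, a ∈ I.adom
  writable : ∀ f a v, DBFact.feature f a v ∈ I.facts → v ∈ 𝔻.writable f
  factList : List (DBFact 𝔻)
  mem_factList : ∀ φ, φ ∈ factList ↔ φ ∈ I.facts
  posList : List IndName
  mem_posList : ∀ a, a ∈ posList ↔ a ∈ P
  negList : List IndName
  mem_negList : ∀ a, a ∈ negList ↔ a ∈ N

/-- The question of the fitting problem for the logic `L`: is there a fitting `L` concept? -/
def HasFitting {𝔻 : FeatureDomains} (L : Set (Concept 𝔻)) (x : FittingInput 𝔻) : Prop :=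
  ∃ C ∈ L, Fits x.I x.P x.N C

/-! ### Inputs as words over a finite alphabet, and polynomial time -/

/-- The input alphabet: two bits, a symbol that ends a word, and five symbols that announce a fact
of each of the three forms, a positive example, and a negative example. -/
inductive Sym where
  | bit (b : Bool)
  | sep
  | concept
  | role
  | feature
  | pos
  | neg
  deriving DecidableEq, Fintype

/-- A binary word, followed by the end symbol. -/
def encodeWord (w : List Bool) : List Sym := w.map Sym.bit ++ [Sym.sep]

def DBFact.encode {𝔻 : FeatureDomains} : DBFact 𝔻 → List Sym
  | .concept A a => Sym.concept :: (encodeWord A ++ encodeWord a)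
  | .role r a b => Sym.role :: (encodeWord r ++ encodeWord a ++ encodeWord b)
  | .feature f a v => Sym.feature :: (encodeWord f ++ encodeWord a ++ encodeWord (𝔻.code f v))

/-- The word for an input: its facts, then its positive, then its negative examples. -/
def FittingInput.encode {𝔻 : FeatureDomains} (x : FittingInput 𝔻) : List Sym :=
  x.factList.flatMap DBFact.encode ++
    x.posList.flatMap (fun a => Sym.pos :: encodeWord a) ++
    x.negList.flatMap (fun a => Sym.neg :: encodeWord a)

/-- The decision problem `Q`, with inputs written as words by `enc`, is decided by a Turing machine
whose number of steps is bounded by a polynomial in the length of the input word. -/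
def DecidableInPolyTime {α Γ : Type} (enc : α → List Γ) (Q : α → Prop) : Prop :=
  ∃ f : α → Bool, (∀ x, f x = true ↔ Q x) ∧
    Nonempty (Turing.TM2ComputableInPolyTime enc Computability.encodeBool f)

end DL

/-!
Two individuals are indistinguishable if they belong to the same concepts of the logic. There is a
fitting concept iff no positive example is indistinguishable from a negative example
(`hasFitting_iff`): the individuals that are indistinguishable from a positive example form a union
of classes, and since the database is finite and the concepts are closed under Boolean operations,
every union of classes is the extension of a concept (`exists_concept_ext_eq`).

Indistinguishability is computed by partition refinement. At stage `0`, individuals are related if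
they have the same concept names and feature values (the concepts `f ≤ v` and `f ≥ v` together say
that the value is `v`); at each further stage, related individuals that have different numbers of
successors in some class, along some role, are separated. This is the relation `Sim`. Each stage is
sound because each class is definable, and after as many stages as there are pairs of individuals
nothing changes any more, so that all concepts are respected (`indist_iff_sim`). The four logics
differ only in the roles that are taken into account and in whether stage `0` looks at the features.
Concepts are never written down, so their size does not matter.

For the time bound, the refinement is described logically. The positions of the input word are the
elements of a structure, individuals are represented by the positions before their names, and each
step of the computation redefines a binary relation on the positions by a formula with comparisons
of cardinalities (`Fm`); formulas and loops over the positions are combined to commands (`Cmd`).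
Such a description has a polynomial running time for structural reasons: the variables become two-way
heads on the input word, the relations become bit tables of quadratic length, and evaluating a formula
needs a bounded nesting of loops over the positions. This is carried out with structured programs on
finitely many stacks (`Prog`), which are compiled to the machines of `Turing.TM2` (`Run.reach`). The
result is `decidableInPolyTime_of_holds`: a problem described by a command and a formula is decidable
in polynomial time. The correctness of the description of the refinement is `holds_answerFm_iff`.
-/

namespace DL

/-! ### Structured stack programs -/

section Machine

variable {K Γ : Type}

/-- Structured programs over stacks indexed by `K`, all with the alphabet `Γ`, and one flag.
`set` changes the flag, `test k f` sets it according to the top of the stack `k`, `copy k l` pushes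
the top of `k` on `l`, `ite` branches on the flag, and `loop k c` repeats `c` as long as the stack
`k` is nonempty. -/
inductive Prog (K Γ : Type) where
  | set (f : Bool → Bool)
  | test (k : K) (f : Option Γ → Bool)
  | push (k : K) (a : Γ)
  | pop (k : K)
  | copy (k l : K)
  | seq (c d : Prog K Γ)
  | ite (c d : Prog K Γ)
  | loop (k : K) (c : Prog K Γ)

/-- The contents of the stacks after the top of `k`, if there is one, is pushed on `l`. -/
def copyTop [DecidableEq K] (S : K → List Γ) (k l : K) : K → List Γ :=
  match S k with
  | [] => S
  | a :: _ => Function.update S l (a :: S l)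

/-- `Run c b S t b' S'`: started with the flag `b` and the stacks `S`, the program `c` ends with
the flag `b'` and the stacks `S'` after at most `t` steps. The rule `weaken` makes `t` an upper
bound, so that all bounds below can be polynomials. -/
inductive Run [DecidableEq K] : Prog K Γ → Bool → (K → List Γ) → ℕ → Bool → (K → List Γ) → Prop
  | set (f b S) : Run (.set f) b S 1 (f b) S
  | test (k f b S) : Run (.test k f) b S 1 (f (S k).head?) S
  | push (k a b S) : Run (.push k a) b S 1 b (Function.update S k (a :: S k))
  | pop (k b S) : Run (.pop k) b S 1 b (Function.update S k (S k).tail)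
  | copy (k l b S) : Run (.copy k l) b S 1 b (copyTop S k l)
  | seq {c d b S t b' S' t' b'' S''} : Run c b S t b' S' → Run d b' S' t' b'' S'' →
      Run (.seq c d) b S (t + t') b'' S''
  | ite_true {c d S t b' S'} : Run c true S t b' S' → Run (.ite c d) true S (1 + t) b' S'
  | ite_false {c d S t b' S'} : Run d false S t b' S' → Run (.ite c d) false S (1 + t) b' S'
  | loop_nil {k c b S} : S k = [] → Run (.loop k c) b S 1 b S
  | loop_cons {k c b S t b' S' t' b'' S''} : S k ≠ [] → Run c b S t b' S' →
      Run (.loop k c) b' S' t' b'' S'' → Run (.loop k c) b S (1 + t + t') b'' S''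
  | weaken {c b S t b' S' t'} : Run c b S t b' S' → t ≤ t' → Run c b S t' b' S'

/-! ### Compilation to Turing machines -/

/-- The labels of the machine code of a program. -/
def Prog.Lab : Prog K Γ → Type
  | .seq c d => c.Lab ⊕ d.Lab
  | .ite c d => Option (c.Lab ⊕ d.Lab)
  | .loop _ c => Option c.Lab
  | _ => Unit

noncomputable instance Prog.fintypeLab : ∀ c : Prog K Γ, Fintype c.Lab
  | .seq c d => @instFintypeSum _ _ c.fintypeLab d.fintypeLab
  | .ite c d => @instFintypeOption _ (@instFintypeSum _ _ c.fintypeLab d.fintypeLab)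
  | .loop _ c => @instFintypeOption _ c.fintypeLab
  | .set _ => inferInstanceAs (Fintype Unit)
  | .test _ _ => inferInstanceAs (Fintype Unit)
  | .push _ _ => inferInstanceAs (Fintype Unit)
  | .pop _ => inferInstanceAs (Fintype Unit)
  | .copy _ _ => inferInstanceAs (Fintype Unit)

/-- The label at which the machine code of a program starts. -/
def Prog.entry : ∀ c : Prog K Γ, c.Lab
  | .seq c _ => Sum.inl c.entry
  | .ite _ _ => (none : Option _)
  | .loop _ _ => (none : Option _)
  | .set _ => ()
  | .test _ _ => ()
  | .push _ _ => ()
  | .pop _ => ()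
  | .copy _ _ => ()

/-- The stack alphabets of the machine: the stack `none` is the output stack. -/
abbrev StackAlphabet (K Γ : Type) : Option K → Type
  | none => Bool
  | some _ => Γ

/-- The internal state of the machine: the flag, and a register that holds a symbol within a
single step and is empty between steps. -/
abbrev MachineState (Γ : Type) : Type := Bool × Option Γ

open Turing.TM2.Stmt in
/-- The machine code of a program, with its labels renamed by `e`; it ends with a jump to `x`. -/
def Prog.code [Inhabited Γ] {Λ : Type} : ∀ c : Prog K Γ, (c.Lab → Λ) → Λ → c.Lab →
    Turing.TM2.Stmt (StackAlphabet K Γ) Λ (MachineState Γ)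
  | .set f, _, x, _ => load (fun v => (f v.1, none)) (goto fun _ => x)
  | .test k f, _, x, _ => peek (some k) (fun _ o => (f o, none)) (goto fun _ => x)
  | .push k a, _, x, _ => Turing.TM2.Stmt.push (some k) (fun _ => a) (goto fun _ => x)
  | .pop k, _, x, _ => Turing.TM2.Stmt.pop (some k) (fun v _ => v) (goto fun _ => x)
  | .copy k l, _, x, _ => peek (some k) (fun v o => (v.1, o))
      (branch (fun v => v.2.isSome)
        (Turing.TM2.Stmt.push (some l) (fun v => (v.2.getD default : Γ))
          (load (fun v => (v.1, none)) (goto fun _ => x)))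
        (goto fun _ => x))
  -- the first program jumps to the entry of the second one, a branch to the common exit, and the
  -- body of a loop back to the test
  | .seq c d, e, _, .inl l => c.code (fun l => e (.inl l)) (e (.inr d.entry)) l
  | .seq _ d, e, x, .inr l => d.code (fun l => e (.inr l)) x l
  | .ite c d, e, _, none => goto fun v => if v.1 then e (some (.inl c.entry))
      else e (some (.inr d.entry))
  | .ite c _, e, x, some (.inl l) => c.code (fun l => e (some (.inl l))) x l
  | .ite _ d, e, x, some (.inr l) => d.code (fun l => e (some (.inr l))) x l
  | .loop k c, e, x, none => peek (some k) (fun v o => (v.1, o))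
      (branch (fun v => v.2.isSome)
        (load (fun v => (v.1, none)) (goto fun _ => e (some c.entry)))
        (goto fun _ => x))
  | .loop _ c, e, _, some l => c.code (fun l => e (some l)) (e none) l

/-- The stacks of the machine: the stacks of the program and an output stack. -/
def allStacks (S : K → List Γ) (o : List Bool) : ∀ k, List (StackAlphabet K Γ k)
  | none => o
  | some k => S k

@[simp] lemma allStacks_some (S : K → List Γ) (o : List Bool) (k : K) :
    allStacks S o (some k) = S k := rfl

variable [DecidableEq K]

@[simp] lemma update_allStacks_some (S : K → List Γ) (o : List Bool) (k : K) (l : List Γ) :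
    Function.update (allStacks S o) (some k) l = allStacks (Function.update S k l) o := by
  funext k'
  cases k' with
  | none => rfl
  | some k' =>
    by_cases h : k' = k
    · subst h
      rw [Function.update_self, allStacks_some, Function.update_self]
    · rw [Function.update_of_ne (by simpa using h), allStacks_some, allStacks_some,
        Function.update_of_ne h]

/-- The machine `M` goes from the configuration `a` to `b` in at most `t` steps. -/
def Reach {Λ : Type} (M : Λ → Turing.TM2.Stmt (StackAlphabet K Γ) Λ (MachineState Γ)) (t : ℕ)
    (a b : Turing.TM2.Cfg (StackAlphabet K Γ) Λ (MachineState Γ)) : Prop :=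
  ∃ m ≤ t, (flip bind (Turing.TM2.step M))^[m] (some a) = some b

variable {Λ : Type} {M : Λ → Turing.TM2.Stmt (StackAlphabet K Γ) Λ (MachineState Γ)}

lemma Reach.mono {t t' a b} (h : Reach M t a b) (ht : t ≤ t') : Reach M t' a b := by
  obtain ⟨m, hm, e⟩ := h
  exact ⟨m, hm.trans ht, e⟩

lemma Reach.trans {t t' a b c} (h : Reach M t a b) (h' : Reach M t' b c) :
    Reach M (t + t') a c := by
  obtain ⟨m, hm, e⟩ := h
  obtain ⟨m', hm', e'⟩ := h'
  refine ⟨m' + m, by omega, ?_⟩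
  rw [Function.iterate_add_apply, e, e']

lemma Reach.single {a b} (h : Turing.TM2.step M a = some b) : Reach M 1 a b :=
  ⟨1, le_rfl, h⟩

/-- The machine code of a program simulates its runs. The labels of the program may be a part of
the labels of a larger machine, which is what the induction needs. -/
theorem Run.reach [Inhabited Γ] {c : Prog K Γ} {b S t b' S'} (h : Run c b S t b' S')
    (e : c.Lab → Λ) (x : Λ) (he : ∀ l, M (e l) = c.code e x l) (o : List Bool) :
    Reach M t ⟨some (e c.entry), (b, none), allStacks S o⟩
      ⟨some x, (b', none), allStacks S' o⟩ := by
  induction h generalizing x with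
  | set f b S =>
    apply Reach.single
    simp [he, Prog.code]
  | test k f b S =>
    apply Reach.single
    simp [he, Prog.code]
  | push k a b S =>
    apply Reach.single
    simp only [Turing.TM2.step, he, Prog.code, Turing.TM2.stepAux]
    congr 2
    exact update_allStacks_some S o k _
  | pop k b S =>
    apply Reach.single
    simp only [Turing.TM2.step, he, Prog.code, Turing.TM2.stepAux]
    congr 2
    exact update_allStacks_some S o k _
  | copy k l b S =>
    apply Reach.single
    simp only [Turing.TM2.step, he, Prog.code, Turing.TM2.stepAux, allStacks_some]
    unfold copyTop
    cases hk : S k with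
    | nil => simp
    | cons a t' =>
      simp only [List.head?_cons, Option.isSome_some, cond_true]
      rw [update_allStacks_some]
      simp
  | @seq c d b S t b' S' t' b'' S'' _ _ ih1 ih2 =>
    exact (ih1 _ _ fun l => he (.inl l)).trans (ih2 _ _ fun l => he (.inr l))
  | @ite_true c d S t b' S' _ ih =>
    refine (Reach.single ?_).trans (ih (fun l => e (some (.inl l))) x fun l => he (some (.inl l)))
    change some (Turing.TM2.stepAux (M (e none)) _ _) = _
    rw [he none]; rfl
  | @ite_false c d S t b' S' _ ih =>
    refine (Reach.single ?_).trans (ih (fun l => e (some (.inr l))) x fun l => he (some (.inr l)))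
    change some (Turing.TM2.stepAux (M (e none)) _ _) = _
    rw [he none]; rfl
  | @loop_nil k c b S hk =>
    apply Reach.single
    change some (Turing.TM2.stepAux (M (e none)) _ _) = _
    rw [he none]
    simp only [Prog.code, Turing.TM2.stepAux]
    change some (bif (S k).head?.isSome then _ else _) = _
    simp [hk]
  | @loop_cons k c b S t b' S' t' b'' S'' hk _ _ ih1 ih2 =>
    refine ((Reach.single ?_).trans (ih1 (fun l => e (some l)) (e none)
      fun l => he (some l))).trans (ih2 e x he)
    change some (Turing.TM2.stepAux (M (e none)) _ _) = _
    rw [he none]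
    simp only [Prog.code, Turing.TM2.stepAux]
    change some (bif (S k).head?.isSome then _ else _) = _
    cases hS : S k with
    | nil => exact absurd hS hk
    | cons => rfl
  | weaken _ ht ih => exact (ih e x he).mono ht

end Machine

/-! ### Programs with a polynomial time bound -/

section Machine

variable {K Γ : Type} [DecidableEq K]

lemma length_copyTop_le (S : K → List Γ) (k l j : K) :
    (copyTop S k l j).length ≤ (S j).length + 1 := by
  unfold copyTop
  cases h : S k with
  | nil => simp
  | cons a t =>
    by_cases hj : j = l
    · subst hj; simp
    · simp [hj]

/-- Every step makes a stack longer by at most one symbol. -/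
theorem Run.length_le {c : Prog K Γ} {b S t b' S'} (h : Run c b S t b' S') (j : K) :
    (S' j).length ≤ (S j).length + t := by
  induction h with
  | push k a b S =>
    by_cases hj : j = k
    · subst hj; simp
    · simp [hj]
  | pop k b S =>
    by_cases hj : j = k
    · subst hj; simp; omega
    · simp [hj]
  | copy k l b S => exact length_copyTop_le S k l j
  | _ => omega

/-- Empty the stacks in a list. -/
def Prog.clear : List K → Prog K Γ
  | [] => .set id
  | k :: l => .seq (.loop k (.pop k)) (clear l)

lemma run_clear_stack (k : K) (b : Bool) (m : ℕ) (S : K → List Γ) (h : (S k).length ≤ m) :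
    Run (.loop k (.pop k)) b S (2 * m + 1) b (Function.update S k []) := by
  induction m generalizing S with
  | zero =>
    have h0 : S k = [] := List.length_eq_zero_iff.1 (by omega)
    have h1 : Function.update S k [] = S := by rw [← h0, Function.update_eq_self]
    rw [h1]
    exact Run.weaken (.loop_nil h0) (by omega)
  | succ m ih =>
    by_cases h0 : S k = []
    · have h1 : Function.update S k [] = S := by rw [← h0, Function.update_eq_self]
      rw [h1]
      exact Run.weaken (.loop_nil h0) (by omega)
    · have := ih (Function.update S k (S k).tail) (by simp; omega)
      rw [Function.update_idem] at this
      exact Run.weaken (.loop_cons h0 (.pop k b S) this) (by omega)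

lemma run_clear (m : ℕ) (b : Bool) (l : List K) (S : K → List Γ) (h : ∀ k, (S k).length ≤ m) :
    Run (.clear l) b S (l.length * (2 * m + 1) + 1) b (fun k => if k ∈ l then [] else S k) := by
  induction l generalizing S with
  | nil => simpa [Prog.clear] using Run.set id b S
  | cons k l ih =>
    have h1 := run_clear_stack k b m S (h k)
    have h2 := ih (Function.update S k []) (by
      intro j
      by_cases hj : j = k
      · subst hj; simp
      · simpa [hj] using h j)
    have h3 : (fun j => if j ∈ k :: l then [] else S j) =
        fun j => if j ∈ l then [] else Function.update S k [] j := by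
      funext j
      by_cases hj : j = k
      · subst hj; simp
      · simp [hj]
    rw [h3]
    refine Run.weaken (.seq h1 h2) ?_
    simp only [List.length_cons]
    ring_nf
    omega

/-- The Turing machine of a program: it runs the program, empties all stacks and outputs the
flag. The stacks have to be emptied since `Turing.TM2ComputableInPolyTime` fixes the halting
configuration. -/
noncomputable def Prog.machine [Fintype K] [Fintype Γ] [Inhabited Γ] (c : Prog K Γ) (k₀ : K) :
    Turing.FinTM2 where
  K := Option K
  k₀ := some k₀
  k₁ := none
  Γ := StackAlphabet K Γ
  Λ := Option (c.seq (.clear Finset.univ.toList)).Lab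
  main := some (c.seq (.clear Finset.univ.toList)).entry
  σ := MachineState Γ
  initialState := (false, none)
  m
    | some l => (c.seq (.clear Finset.univ.toList)).code some none l
    | none => .push none (fun v => v.1) (.load (fun _ => (false, none)) .halt)

/-- A problem that is decided by a program in polynomial time is decided by a Turing machine in
polynomial time. -/
theorem decidableInPolyTime_of_run [Fintype K] [Fintype Γ] [Inhabited Γ] {α : Type}
    (enc : α → List Γ) (Q : α → Prop) (c : Prog K Γ) (k₀ : K) (p : Polynomial ℕ)
    (h : ∀ a, ∃ b, (b = true ↔ Q a) ∧ ∃ S', Run c false (Function.update (fun _ => []) k₀ (enc a))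
      (p.eval (enc a).length) b S') :
    DecidableInPolyTime enc Q := by
  choose f hf S' hS' using h
  refine ⟨f, hf, ⟨⟨⟨c.machine k₀, Equiv.refl _, Equiv.refl _⟩,
    p + (Fintype.card K : Polynomial ℕ) * (2 * (Polynomial.X + p) + 1) + 2, fun a => ?_⟩⟩⟩
  apply Classical.choice
  -- the time for emptying the stacks depends on their lengths
  have hlen : ∀ k, (S' a k).length ≤ (enc a).length + p.eval (enc a).length := by
    intro k
    refine ((hS' a).length_le k).trans ?_
    by_cases hk : k = k₀
    · subst hk; simp
    · simp [hk]
  have hrun := Run.seq (hS' a) (run_clear _ (f a) Finset.univ.toList (S' a) hlen)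
  simp only [Finset.mem_toList, Finset.mem_univ, if_true, Finset.length_toList,
    Finset.card_univ] at hrun
  have hreach := hrun.reach (M := (c.machine k₀).m) some none (fun _ => rfl) []
  have hfin : Reach (c.machine k₀).m 1 ⟨some none, (f a, none), allStacks (fun _ => []) []⟩
      ⟨none, (false, none), allStacks (fun _ => []) [f a]⟩ := by
    apply Reach.single
    change some (Turing.TM2.Cfg.mk _ _ _) = _
    congr 2
    funext k
    cases k <;> rfl
  obtain ⟨m, hm, e⟩ := hreach.trans hfin
  refine ⟨⟨⟨m, ?_⟩, ?_⟩⟩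
  · have h1 : Turing.initList (c.machine k₀) (enc a) = ⟨some (some
        (c.seq (.clear Finset.univ.toList)).entry), (false, none),
        allStacks (Function.update (fun _ => []) k₀ (enc a)) []⟩ := by
      unfold Turing.initList
      congr 1
      funext k
      cases k with
      | none => exact dif_neg (by simp [Prog.machine])
      | some k =>
        by_cases hk : k = k₀
        · subst hk
          refine (dif_pos rfl).trans ?_
          rw [allStacks_some, Function.update_self]
          rfl
        · refine (dif_neg (by simpa [Prog.machine] using hk)).trans ?_
          rw [allStacks_some, Function.update_of_ne hk]
          rfl
    have h2 : Turing.haltList (c.machine k₀) [f a] =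
        ⟨none, (false, none), allStacks (fun _ => []) [f a]⟩ := by
      unfold Turing.haltList
      congr 1
      funext k
      cases k with
      | none => exact dif_pos rfl
      | some k => exact dif_neg (by simp [Prog.machine])
    have h3 : List.map (Equiv.refl ((c.machine k₀).Γ (c.machine k₀).k₀)).invFun (enc a) = enc a :=
      List.map_id _
    have h4 : List.map (Equiv.refl ((c.machine k₀).Γ (c.machine k₀).k₁)).invFun
        (Computability.encodeBool (f a)) = [f a] := rfl
    change _ = some (Turing.haltList (c.machine k₀) _)
    erw [h3, h4, h1, h2]
    exact e
  · refine hm.trans (le_of_eq ?_)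
    simp only [Polynomial.eval_add, Polynomial.eval_mul, Polynomial.eval_natCast,
      Polynomial.eval_X, Polynomial.eval_ofNat, Polynomial.eval_one]
    simp
    ring

end Machine

/-! ### Moving the contents of stacks -/

section Move

variable {K Γ : Type} [DecidableEq K]

/-- Move the top of `k`, if there is one, to `l`. -/
def Prog.move (k l : K) : Prog K Γ := .seq (.copy k l) (.pop k)

/-- The contents of the stacks after the top of `k`, if there is one, is moved to `l ≠ k`. -/
def moveTop (S : K → List Γ) (k l : K) : K → List Γ :=
  match S k with
  | [] => S
  | a :: t => Function.update (Function.update S k t) l (a :: S l)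

lemma run_move {k l : K} (hkl : k ≠ l) (b : Bool) (S : K → List Γ) :
    Run (.move k l) b S 2 b (moveTop S k l) := by
  have e : moveTop S k l = Function.update (copyTop S k l) k (copyTop S k l k).tail := by
    unfold moveTop copyTop
    cases h : S k with
    | nil =>
      have h1 : Function.update S k [] = S := by rw [← h, Function.update_eq_self]
      simp [h, h1]
    | cons a t => simp [h, hkl, Function.update_comm hkl.symm]
  rw [e]
  exact Run.seq (Run.copy k l b S) (Run.pop k b _)

lemma iterate_moveTop {k l : K} (hkl : k ≠ l) (m : ℕ) (S : K → List Γ) :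
    (fun S => moveTop S k l)^[m] S = Function.update (Function.update S k ((S k).drop m)) l
      (((S k).take m).reverse ++ S l) := by
  induction m generalizing S with
  | zero => simp
  | succ m ih =>
    rw [Function.iterate_succ_apply, ih]
    unfold moveTop
    cases h : S k with
    | nil => simp [h]
    | cons a t =>
      funext j
      by_cases hj : j = l
      · subst hj; simp [hkl]
      · by_cases hj' : j = k
        · subst hj'; simp [hkl]
        · simp [hj, hj']

/-- Moving a whole stack reverses it. -/
lemma run_move_all {k l : K} (hkl : k ≠ l) (b : Bool) (m : ℕ) (S : K → List Γ)
    (h : (S k).length ≤ m) : Run (.loop k (.move k l)) b S (3 * m + 1) b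
      (Function.update (Function.update S k []) l ((S k).reverse ++ S l)) := by
  induction m generalizing S with
  | zero =>
    have h0 : S k = [] := List.length_eq_zero_iff.1 (by omega)
    refine Run.weaken (t := 1) ?_ (by omega)
    convert Run.loop_nil (b := b) (c := .move k l) h0 using 1
    rw [h0, ← h0, Function.update_eq_self, h0]
    simp
  | succ m ih =>
    cases h0 : S k with
    | nil =>
      refine Run.weaken (t := 1) ?_ (by omega)
      convert Run.loop_nil (b := b) (c := .move k l) h0 using 1
      rw [← h0, Function.update_eq_self, h0]
      simp
    | cons a t =>
      have h1 := ih (moveTop S k l) (by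
        unfold moveTop; rw [h0] at h ⊢; simpa [hkl] using h)
      refine Run.weaken (t := 1 + 2 + (3 * m + 1)) ?_ (by omega)
      convert Run.loop_cons (by simp [h0]) (run_move hkl b S) h1 using 1
      unfold moveTop
      rw [h0]
      funext j
      by_cases hj : j = l
      · subst hj; simp [hkl]
      · by_cases hj' : j = k
        · subst hj'; simp [hkl]
        · simp [hj, hj']

end Move

/-! ### Two-way heads on the input word -/

lemma update_comp_some {V : Type} [DecidableEq V] (h : Option V → ℕ) (x : V) (i : ℕ) :
    (fun v => Function.update h (some x) i (some v)) =
      Function.update (fun v => h (some v)) x i := by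
  funext v
  by_cases hv : v = x
  · subst hv; simp
  · simp [hv]

lemma update_head_le {V : Type} [DecidableEq V] {w : List Sym} {h : Option V → ℕ}
    (hle : ∀ v, h v ≤ w.length) (x : V) {i : ℕ} (hi : i < w.length) (v : Option V) :
    Function.update h (some x) i v ≤ w.length := by
  by_cases hv : v = some x
  · subst hv; simpa using hi.le
  · simpa [hv] using hle v

section Heads

variable {V J : Type}

/-- The auxiliary stacks: an array for every relation symbol, a stack on which a new array is
built, two stacks that are used while an array is read, and two counters for every variable and
for the extra head. -/
inductive Aux (V J : Type) where
  | array (j : J)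
  | fresh
  | row
  | tmp
  | count (v : Option V) (i : Bool)
  deriving DecidableEq, Fintype

/-- All stacks. A two-way head `v` on the input word is a pair of stacks, `left v` and `right v`.
There is a head for every variable, and the extra head `none`. -/
inductive Stk (V J : Type) where
  | left (v : Option V)
  | right (v : Option V)
  | aux (a : Aux V J)
  deriving DecidableEq, Fintype

/-- The stacks that represent the input word `w`, the positions `h` of the heads and the contents
`o` of the auxiliary stacks. -/
def layout (w : List Sym) (h : Option V → ℕ) (o : Aux V J → List Sym) : Stk V J → List Sym
  | .left v => (w.take (h v)).reverse
  | .right v => w.drop (h v)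
  | .aux a => o a

variable (w : List Sym) (h : Option V → ℕ) (o : Aux V J → List Sym)

@[simp] lemma layout_left (v) : layout w h o (.left v) = (w.take (h v)).reverse := rfl

@[simp] lemma layout_right (v) : layout w h o (.right v) = w.drop (h v) := rfl

@[simp] lemma layout_aux (a) : layout w h o (.aux a) = o a := rfl

variable [DecidableEq V] [DecidableEq J]

@[simp] lemma update_layout_aux (a : Aux V J) (l : List Sym) :
    Function.update (layout w h o) (.aux a) l = layout w h (Function.update o a l) := by
  funext k
  rcases k with v | v | a'
  · simp
  · simp
  · by_cases ha : a' = a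
    · subst ha; simp
    · simp [ha]

@[simp] lemma moveTop_layout_aux (a a' : Aux V J) :
    moveTop (layout w h o) (.aux a) (.aux a') = layout w h (moveTop o a a') := by
  unfold moveTop
  cases ha : o a with
  | nil => simp [ha]
  | cons x t => simp [ha]

variable {w h}

lemma moveTop_layout_right {v : Option V} (hv : h v < w.length) :
    moveTop (layout w h o) (.right v) (.left v) =
      layout w (Function.update h v (h v + 1)) o := by
  unfold moveTop
  rw [layout_right, List.drop_eq_getElem_cons hv]
  funext k
  rcases k with u | u | a
  · by_cases hu : u = v
    · subst hu
      have e : layout w (Function.update h u (h u + 1)) o (.left u) =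
          w[h u] :: (w.take (h u)).reverse := by
        rw [layout_left, Function.update_self, ← List.take_append_getElem hv, List.reverse_append]
        rfl
      rw [e]
      simp
    · simp [hu]
  · by_cases hu : u = v
    · subst hu
      simp
    · simp [hu]
  · simp

lemma moveTop_layout_left {v : Option V} {i : ℕ} (hv : h v = i + 1) (hi : i < w.length) :
    moveTop (layout w h o) (.left v) (.right v) = layout w (Function.update h v i) o := by
  unfold moveTop
  rw [layout_left, hv, ← List.take_append_getElem hi, List.reverse_append, List.reverse_singleton,
    List.singleton_append]
  funext k
  rcases k with u | u | a
  · by_cases hu : u = v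
    · subst hu
      simp
    · simp [hu]
  · by_cases hu : u = v
    · subst hu
      simp [hv]
    · simp [hu]
  · simp

/-- Run `c` with the head `v` at every position of the input word. -/
def Prog.headLoop (v : Option V) (c : Prog (Stk V J) Sym) : Prog (Stk V J) Sym :=
  .seq (.loop (.right v) (.seq c (.move (.right v) (.left v))))
    (.loop (.left v) (.move (.left v) (.right v)))

/-- The sequences `b` and `o` describe the flag and the auxiliary stacks before each round. The head
returns to the start of the word at the end. -/
lemma run_headLoop (v : Option V) (c : Prog (Stk V J) Sym) (b : ℕ → Bool)
    (o : ℕ → Aux V J → List Sym) (t : ℕ) (hv : h v = 0)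
    (hc : ∀ i < w.length, Run c (b i) (layout w (Function.update h v i) (o i)) t (b (i + 1))
      (layout w (Function.update h v i) (o (i + 1)))) :
    Run (.headLoop v c) (b 0) (layout w h (o 0)) (w.length * (t + 6) + 2) (b w.length)
      (layout w h (o w.length)) := by
  have key : ∀ m i, i + m = w.length →
      Run (.loop (.right v) (.seq c (.move (.right v) (.left v)))) (b i)
        (layout w (Function.update h v i) (o i)) (m * (t + 3) + 1) (b w.length)
        (layout w (Function.update h v w.length) (o w.length)) := by
    intro m
    induction m with
    | zero =>
      intro i hi
      obtain rfl : i = w.length := by omega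
      exact Run.weaken (.loop_nil (by simp)) (by omega)
    | succ m ih =>
      intro i hi
      have hi' : i < w.length := by omega
      have h1 := run_move (k := Stk.right v) (l := .left v) (by simp) (b (i + 1))
        (layout w (Function.update h v i) (o (i + 1)))
      rw [moveTop_layout_right _ (by simpa using hi'), Function.update_self,
        Function.update_idem] at h1
      refine Run.weaken (.loop_cons ?_ (.seq (hc i hi') h1) (ih (i + 1) (by omega))) ?_
      · simpa using hi'
      · rw [Nat.add_mul]; omega
  have h1 := key w.length 0 (by omega)
  have h2 := run_move_all (k := Stk.left v) (l := .right v) (by simp) (b w.length) w.length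
    (layout w (Function.update h v w.length) (o w.length)) (by simp)
  have e0 : Function.update h v 0 = h := by rw [← hv, Function.update_eq_self]
  rw [e0] at h1
  refine Run.weaken (.seq h1 ?_) (t := w.length * (t + 3) + 1 + (3 * w.length + 1)) ?_
  · convert h2 using 1
    funext k
    rcases k with u | u | a
    · by_cases hu : u = v
      · subst hu; simp [hv]
      · simp [hu]
    · by_cases hu : u = v
      · subst hu; simp [hv]
      · simp [hu]
    · simp
  · ring_nf; omega

/-- Run `c` as often as the position of the head `v` says. The head moves to the start of the word
and back; the stack `tmp` counts how far it has to go back. -/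
def Prog.repeatHead (v : Option V) (c : Prog (Stk V J) Sym) : Prog (Stk V J) Sym :=
  .seq (.loop (.left v) (.seq (.move (.left v) (.right v))
      (.seq (.push (.aux .tmp) .sep) c)))
    (.loop (.aux .tmp) (.seq (.pop (.aux .tmp)) (.move (.right v) (.left v))))

lemma run_repeatHead (v : Option V) (c : Prog (Stk V J) Sym) (b : Bool)
    (o : ℕ → Aux V J → List Sym) (t : ℕ) (hv : h v ≤ w.length) (ho : ∀ i, o i .tmp = [])
    (hc : ∀ i l k, Run c b (layout w (Function.update h v k) (Function.update (o i) .tmp l)) t b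
      (layout w (Function.update h v k) (Function.update (o (i + 1)) .tmp l))) :
    Run (.repeatHead v c) b (layout w h (o 0)) (h v * (t + 8) + 2) b
      (layout w h (o (h v))) := by
  have key : ∀ k i, i + k = h v → Run (.loop (.left v) (.seq (.move (.left v) (.right v))
      (.seq (.push (.aux .tmp) .sep) c))) b
        (layout w (Function.update h v k) (Function.update (o i) .tmp (List.replicate i .sep)))
        (k * (t + 4) + 1) b
        (layout w (Function.update h v 0)
          (Function.update (o (h v)) .tmp (List.replicate (h v) .sep))) := by
    intro k
    induction k with
    | zero =>
      intro i hi
      obtain rfl : i = h v := by omega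
      exact Run.weaken (.loop_nil (by simp)) (by omega)
    | succ k ih =>
      intro i hi
      have h1 := run_move (k := Stk.left v) (l := .right v) (by simp) b
        (layout w (Function.update h v (k + 1))
          (Function.update (o i) .tmp (List.replicate i .sep)))
      rw [moveTop_layout_left (i := k) _ (by simp) (by omega), Function.update_idem] at h1
      have h2 := Run.push (.aux .tmp) .sep b (layout w (Function.update h v k)
          (Function.update (o i) .tmp (List.replicate i .sep)))
      rw [update_layout_aux, Function.update_idem, layout_aux, Function.update_self,
        ← List.replicate_succ] at h2
      refine Run.weaken (.loop_cons ?_ (.seq h1 (.seq h2 (hc i _ k))) (ih (i + 1) (by omega))) ?_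
      · rw [layout_left, Function.update_self, ← List.length_pos_iff]
        simp
        omega
      · rw [Nat.add_mul]; omega
  have key' : ∀ k i, i + k = h v → Run (.loop (.aux .tmp) (.seq (.pop (.aux .tmp))
      (.move (.right v) (.left v)))) b
        (layout w (Function.update h v i)
          (Function.update (o (h v)) .tmp (List.replicate k .sep)))
        (k * 4 + 1) b (layout w h (o (h v))) := by
    intro k
    induction k with
    | zero =>
      intro i hi
      obtain rfl : i = h v := by omega
      have e : Function.update (o (h v)) .tmp [] = o (h v) := by
        rw [← ho (h v), Function.update_eq_self]
      simp only [Function.update_eq_self, List.replicate_zero, e]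
      exact Run.weaken (.loop_nil (by simp [ho])) (by omega)
    | succ k ih =>
      intro i hi
      have h1 := Run.pop (.aux .tmp) b (layout w (Function.update h v i)
          (Function.update (o (h v)) .tmp (List.replicate (k + 1) .sep)))
      rw [update_layout_aux, Function.update_idem, layout_aux, Function.update_self,
        List.replicate_succ, List.tail_cons] at h1
      have h2 := run_move (k := Stk.right v) (l := .left v) (by simp) b
        (layout w (Function.update h v i)
          (Function.update (o (h v)) .tmp (List.replicate k .sep)))
      rw [moveTop_layout_right _ (by simp; omega), Function.update_self,
        Function.update_idem] at h2
      refine Run.weaken (.loop_cons ?_ (.seq h1 h2) (ih (i + 1) (by omega))) ?_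
      · simp
      · rw [Nat.add_mul]; omega
  have h1 := key (h v) 0 (by omega)
  have h2 := key' (h v) 0 (by omega)
  have e : Function.update (o 0) .tmp [] = o 0 := by rw [← ho 0, Function.update_eq_self]
  rw [Function.update_eq_self, List.replicate_zero, e] at h1
  refine Run.weaken (.seq h1 h2) ?_
  ring_nf; omega

/-- Compare the two counters of `v` and empty them. The flag tells whether the counter `false` is at
most the counter `true`. -/
def Prog.compareCounts (v : Option V) : Prog (Stk V J) Sym :=
  .seq (.loop (.aux (.count v true)) (.seq (.pop (.aux (.count v true)))
      (.pop (.aux (.count v false)))))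
    (.seq (.test (.aux (.count v false)) (fun x => x.isNone))
      (.loop (.aux (.count v false)) (.pop (.aux (.count v false)))))

lemma run_compareCounts (v : Option V) (b : Bool) (h : Option V → ℕ) (o : Aux V J → List Sym)
    (m : ℕ) (hm : (o (.count v false)).length ≤ m) (hm' : (o (.count v true)).length ≤ m) :
    Run (.compareCounts v) b (layout w h o) (5 * m + 3)
      (decide ((o (.count v false)).length ≤ (o (.count v true)).length))
      (layout w h (Function.update (Function.update o (.count v true) []) (.count v false) [])) := by
  have key : ∀ l, ∀ o : Aux V J → List Sym, o (.count v true) = l →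
      Run (.loop (.aux (.count v true)) (.seq (.pop (.aux (.count v true)))
      (.pop (.aux (.count v false))))) b (layout w h o) (3 * l.length + 1) b
      (layout w h (Function.update (Function.update o (.count v true) []) (.count v false)
        ((o (.count v false)).drop l.length))) := by
    intro l
    induction l with
    | nil =>
      intro o ho
      have e : Function.update (Function.update o (.count v true) []) (.count v false)
        ((o (.count v false)).drop 0) = o := by rw [← ho]; simp
      rw [List.length_nil, e]
      exact Run.weaken (.loop_nil (by simp [ho])) (by omega)
    | cons a l ih =>
      intro o ho
      have h1 := Run.pop (.aux (.count v true)) b (layout w h o)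
      rw [update_layout_aux, layout_aux, ho, List.tail_cons] at h1
      have h2 := Run.pop (.aux (.count v false)) b
        (layout w h (Function.update o (.count v true) l))
      rw [update_layout_aux, layout_aux] at h2
      have h3 := ih _ (by simp : Function.update (Function.update o (.count v true) l)
        (.count v false) (Function.update o (.count v true) l (.count v false)).tail
        (.count v true) = l)
      refine Run.weaken (t := 1 + (1 + 1) + (3 * l.length + 1)) ?_ (by simp; omega)
      convert Run.loop_cons (by simp [ho]) (.seq h1 h2) h3 using 2
      funext a
      by_cases ha : a = .count v false
      · subst ha
        simp
      · by_cases ha' : a = .count v true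
        · subst ha'; simp
        · simp [ha, ha']
  have h1 := key _ o rfl
  set o' := Function.update (Function.update o (.count v true) []) (.count v false)
        ((o (.count v false)).drop (o (.count v true)).length) with ho'
  have h2 := Run.test (.aux (.count v false)) (fun x => x.isNone) b (layout w h o')
  have h3 := run_clear_stack (.aux (.count v false)) (decide ((o (.count v false)).length ≤
    (o (.count v true)).length)) m (layout w h o') (by simp [ho']; omega)
  have e : (((layout w h o') (.aux (.count v false))).head?).isNone =
      decide ((o (.count v false)).length ≤ (o (.count v true)).length) := by
    rw [Bool.eq_iff_iff]
    simp [ho']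
  rw [e] at h2
  refine Run.weaken (t := 3 * (o (.count v true)).length + 1 + (1 + (2 * m + 1))) ?_ (by omega)
  rw [update_layout_aux, ho', Function.update_idem] at h3
  exact Run.seq h1 (.seq h2 h3)

end Heads

/-! ### First-order formulas with counting over the positions of a word -/

section Formulas

variable {V J : Type} [DecidableEq V] [DecidableEq J]

/-- Formulas that speak about the positions of the input word and about binary relations `j : J`
on the positions. The formula `cle x φ ψ` says that at most as many positions `x` satisfy `φ` as
satisfy `ψ`. -/
inductive Fm (V J : Type) where
  | sym (x : V) (s : Sym)
  | rel (j : J) (x y : V)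
  | le (x y : V)
  | not (φ : Fm V J)
  | and (φ ψ : Fm V J)
  | cle (x : V) (φ ψ : Fm V J)

open Classical in
/-- The truth of a formula in the word `w`. A relation is given by the list of its bits, where the
bit of the pair `(i, k)` of positions has the index `i * |w| + k`. -/
def Holds (w : List Sym) (ρ : J → List Sym) : (V → ℕ) → Fm V J → Prop
  | e, .sym x s => w[e x]? = some s
  | e, .rel j x y => (ρ j)[w.length * e x + e y]? = some (.bit true)
  | e, .le x y => e x ≤ e y
  | e, .not φ => ¬ Holds w ρ e φ
  | e, .and φ ψ => Holds w ρ e φ ∧ Holds w ρ e ψ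
  | e, .cle x φ ψ => Nat.count (fun i => Holds w ρ (Function.update e x i) φ) w.length ≤
      Nat.count (fun i => Holds w ρ (Function.update e x i) ψ) w.length

namespace Fm

/-- The variables that are bound in a formula. -/
def bound : Fm V J → Set V
  | .sym _ _ => ∅
  | .rel _ _ _ => ∅
  | .le _ _ => ∅
  | .not φ => φ.bound
  | .and φ ψ => φ.bound ∪ ψ.bound
  | .cle x φ ψ => {x} ∪ (φ.bound ∪ ψ.bound)

/-- No variable is bound again in the scope of a quantifier that binds it. -/
def Proper : Fm V J → Prop
  | .sym _ _ => True
  | .rel _ _ _ => True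
  | .le _ _ => True
  | .not φ => φ.Proper
  | .and φ ψ => φ.Proper ∧ ψ.Proper
  | .cle x φ ψ => (x ∉ φ.bound ∧ x ∉ ψ.bound) ∧ φ.Proper ∧ ψ.Proper

/-- The program that evaluates a formula; the flag receives the truth value. For an atom `rel j x y`
it moves `|w| * x + y` symbols from the array to the stack `row`, tests the next one, and moves
them back. For `cle x φ ψ` the head `x` visits all positions, and two counters are compared. -/
def code : Fm V J → Prog (Stk V J) Sym
  | .sym x s => .test (.right (some x)) (fun a => decide (a = some s))
  | .rel j x y => .seq (.repeatHead (some x) (.headLoop none (.move (.aux (.array j)) (.aux .row))))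
      (.seq (.repeatHead (some y) (.move (.aux (.array j)) (.aux .row)))
        (.seq (.test (.aux (.array j)) (fun a => decide (a = some (.bit true))))
          (.loop (.aux .row) (.move (.aux .row) (.aux (.array j))))))
  | .le x y => .seq (.repeatHead (some x) (.push (.aux (.count none false)) .sep))
      (.seq (.repeatHead (some y) (.push (.aux (.count none true)) .sep))
        (.compareCounts none))
  | .not φ => .seq φ.code (.set Bool.not)
  | .and φ ψ => .seq φ.code (.ite ψ.code (.set id))
  | .cle x φ ψ => .seq (.headLoop (some x)
        (.seq φ.code (.seq (.ite (.push (.aux (.count (some x) false)) .sep) (.set id))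
          (.seq ψ.code (.ite (.push (.aux (.count (some x) true)) .sep) (.set id))))))
      (.compareCounts (some x))

/-- A bound on the number of steps of the evaluation, as a function of the length of the word. -/
noncomputable def time : Fm V J → Polynomial ℕ
  | .sym _ _ => 1
  | .rel _ _ _ => (Polynomial.X * (Polynomial.X * 8 + 10) + 2) + ((Polynomial.X * 10 + 2) +
      (1 + (3 * (Polynomial.X * Polynomial.X + Polynomial.X) + 1)))
  | .le _ _ => (Polynomial.X * 9 + 2) + ((Polynomial.X * 9 + 2) + (5 * Polynomial.X + 3))
  | .not φ => φ.time + 1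
  | .and φ ψ => φ.time + (1 + (ψ.time + 1))
  | .cle _ φ ψ => (Polynomial.X * ((φ.time + (2 + (ψ.time + 2))) + 6) + 2) +
      (5 * Polynomial.X + 3)

end Fm

lemma Run.cast {K Γ : Type} [DecidableEq K] {c : Prog K Γ} {b S t b' S' t' b'' S''}
    (h : Run c b S t b' S') (ht : t = t') (hb : b' = b'') (hS : S' = S'') :
    Run c b S t' b'' S'' := by
  subst ht hb hS; exact h

lemma update_moveTop_tmp (o : Aux V J → List Sym) (j : J) (l : List Sym) (m : ℕ) :
    (fun S => moveTop S (.array j) .row)^[m] (Function.update o .tmp l) =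
      Function.update ((fun S => moveTop S (.array j) .row)^[m] o) .tmp l := by
  rw [iterate_moveTop (by simp), iterate_moveTop (by simp)]
  funext a
  by_cases h1 : a = .tmp
  · subst h1; simp
  · by_cases h2 : a = .row
    · subst h2; simp
    · by_cases h3 : a = .array j
      · subst h3; simp
      · simp [h1, h2, h3]

lemma run_read_array {w : List Sym} {h : Option V → ℕ} {o : Aux V J → List Sym} {b : Bool} {j : J}
    {x y : V} (hle : ∀ v, h v ≤ w.length) (hnone : h none = 0) (htmp : o .tmp = [])
    (hrow : o .row = []) :
    Run (Fm.code (.rel j x y)) b (layout w h o) ((Fm.time (.rel j x y : Fm V J)).eval w.length)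
      (decide ((o (.array j))[w.length * h (some x) + h (some y)]? = some (.bit true)))
      (layout w h o) := by
  set n := w.length with hn
  set F : (Aux V J → List Sym) → (Aux V J → List Sym) := fun S => moveTop S (.array j) .row with hF
  have htmp' : ∀ m, F^[m] o .tmp = [] := fun m => by
    rw [hF, iterate_moveTop (by simp)]
    simp [htmp]
  have h1 := run_repeatHead (some x) (.headLoop none (.move (.aux (.array j)) (.aux .row))) b
    (fun i => F^[n * i] o) (n * 8 + 2) (hle (some x)) (fun i => htmp' _) (by
      intro i l k
      have := run_headLoop none (.move (.aux (.array j)) (.aux .row)) (fun _ => b)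
        (fun m => F^[m] (Function.update (F^[n * i] o) .tmp l)) 2
        (h := Function.update h (some x) k) (w := w) (by simpa using hnone) (by
          intro m _
          have := run_move (k := Stk.aux (.array j)) (l := .aux .row) (by simp) b
            (layout w (Function.update (Function.update h (some x) k) none m)
              (F^[m] (Function.update (F^[n * i] o) .tmp l)))
          rw [moveTop_layout_aux] at this
          simpa only [Function.iterate_succ_apply'] using this)
      simp only [hF, update_moveTop_tmp] at this
      rw [← hn, Function.iterate_zero, id] at this
      convert this using 3
      · rw [hF, ← Function.iterate_add_apply]; congr 2; ring)
  have h2 := run_repeatHead (some y) (.move (.aux (.array j)) (.aux .row)) b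
    (fun i => F^[i] (F^[n * h (some x)] o)) 2 (hle (some y))
    (fun i => by rw [← Function.iterate_add_apply]; exact htmp' _) (by
      intro i l k
      have := run_move (k := Stk.aux (.array j)) (l := .aux .row) (by simp) b
        (layout w (Function.update h (some y) k)
          (Function.update (F^[i] (F^[n * h (some x)] o)) .tmp l))
      rw [moveTop_layout_aux] at this
      convert this using 3
      rw [Function.iterate_succ_apply']
      exact (update_moveTop_tmp _ j l 1).symm)
  simp only [← Function.iterate_add_apply] at h2
  simp only [Nat.mul_zero, Nat.zero_add, Function.iterate_zero, id] at h1 h2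
  rw [Nat.add_comm (h (some y))] at h2
  set m := n * h (some x) + h (some y) with hm
  have hmn : m ≤ n * n + n :=
    Nat.add_le_add (Nat.mul_le_mul le_rfl (hle (some x))) (hle (some y))
  have h3 := Run.test (.aux (.array j)) (fun a => decide (a = some (.bit true))) b
    (layout w h (F^[m] o))
  have h4 := run_move_all (k := Stk.aux (.row : Aux V J)) (l := .aux (.array j)) (by simp)
    (decide ((o (.array j))[m]? = some (.bit true))) (n * n + n) (layout w h (F^[m] o)) (by
      rw [layout_aux, hF, iterate_moveTop (by simp)]
      simp [hrow]; omega)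
  have e : ((layout w h (F^[m] o) (.aux (.array j))).head?) = (o (.array j))[m]? := by
    rw [layout_aux, hF, iterate_moveTop (by simp)]
    simp
  rw [e] at h3
  have e2 : Function.update (Function.update (layout w h (F^[m] o)) (.aux .row) [])
      (.aux (.array j)) ((layout w h (F^[m] o) (.aux .row)).reverse ++
        layout w h (F^[m] o) (.aux (.array j))) = layout w h o := by
    rw [update_layout_aux, update_layout_aux]
    congr 1
    rw [layout_aux, layout_aux, hF, iterate_moveTop (by simp)]
    funext a
    by_cases h2 : a = .row
    · subst h2; simp [hrow]
    · by_cases h3 : a = .array j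
      · subst h3; simp [hrow]
      · simp [h2, h3]
  rw [e2] at h4
  refine Run.weaken (.seq h1 (.seq h2 (.seq h3 h4))) ?_
  simp only [Fm.time, Polynomial.eval_add, Polynomial.eval_mul, Polynomial.eval_X,
    Polynomial.eval_ofNat, Polynomial.eval_one]
  have hx := hle (some x)
  have hy := hle (some y)
  have := Nat.mul_le_mul_right (n * 8 + 10) hx
  rw [show n * 8 + 2 + 8 = n * 8 + 10 from rfl]
  omega

lemma run_le {w : List Sym} {h : Option V → ℕ} {o : Aux V J → List Sym} {b : Bool}
    {x y : V} (hle : ∀ v, h v ≤ w.length) (htmp : o .tmp = [])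
    (hcount : ∀ i, o (.count none i) = []) :
    Run (Fm.code (.le x y)) b (layout w h o) ((Fm.time (.le x y : Fm V J)).eval w.length)
      (decide (h (some x) ≤ h (some y))) (layout w h o) := by
  have hpush : ∀ (v : V) (c : Bool) (o : Aux V J → List Sym), o (.count none c) = [] →
      o .tmp = [] → Run (.repeatHead (some v) (.push (.aux (.count none c)) .sep)) b (layout w h o)
      (h (some v) * 9 + 2) b (layout w h
        (Function.update o (.count none c) (List.replicate (h (some v)) .sep))) := by
    intro v c o hc ht
    have := run_repeatHead (some v) (.push (.aux (.count none c)) .sep) b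
      (fun i => Function.update o (.count none c) (List.replicate i .sep)) 1 (hle (some v))
      (fun i => by simpa using ht) (by
        intro i l k
        have := Run.push (.aux (.count none c)) .sep b (layout w (Function.update h (some v) k)
          (Function.update (Function.update o (.count none c) (List.replicate i .sep)) .tmp l))
        rw [update_layout_aux] at this
        convert this using 2
        simp only [layout_aux]
        rw [Function.update_comm (a := Aux.count none c) (b := Aux.tmp) (by simp)]
        rw [Function.update_comm (a := Aux.count none c) (b := Aux.tmp) (by simp)]
        simp [List.replicate_succ])
    have e : Function.update o (.count none c) (List.replicate 0 .sep) = o := by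
      rw [List.replicate_zero, ← hc, Function.update_eq_self]
    rwa [e] at this
  have h1 := hpush x false o (hcount _) htmp
  have h2 := hpush y true (Function.update o (.count none false)
    (List.replicate (h (some x)) .sep)) (by simp [hcount]) (by simp [htmp])
  have h3 := run_compareCounts (w := w) none b h (Function.update (Function.update o
    (.count none false) (List.replicate (h (some x)) .sep)) (.count none true)
    (List.replicate (h (some y)) .sep)) w.length (by simpa using hle _) (by simpa using hle _)
  have e : Function.update (Function.update (Function.update (Function.update o
      (.count none false) (List.replicate (h (some x)) .sep)) (.count none true)
      (List.replicate (h (some y)) .sep)) (.count none true) []) (.count none false) [] = o := by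
    funext a
    by_cases h2 : a = .count none false
    · subst h2; simp [hcount]
    · by_cases h3 : a = .count none true
      · subst h3; simp [hcount]
      · simp [h2, h3]
  rw [e] at h3
  simp only [Function.update_self, List.length_replicate, ne_eq, Aux.count.injEq, true_and,
    Bool.false_eq_true, not_false_eq_true, Function.update_of_ne] at h3
  refine Run.weaken (.seq h1 (.seq h2 h3)) ?_
  simp only [Fm.time, Polynomial.eval_add, Polynomial.eval_mul, Polynomial.eval_X,
    Polynomial.eval_ofNat]
  have hx := hle (some x)
  have hy := hle (some y)
  omega

lemma run_count (k : Stk V J) (b : Bool) (S : Stk V J → List Sym) :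
    Run (.ite (.push k .sep) (.set id)) b S 2 b
      (if b then Function.update S k (.sep :: S k) else S) := by
  cases b
  · exact Run.ite_false (.set id false S)
  · exact Run.ite_true (.push k .sep true S)

open Classical in
/-- The program of a formula computes its truth value and restores all stacks. The heads and the
counters of the bound variables have to be in their initial state; `Proper` guarantees this for
the subformulas. -/
theorem Fm.run_code {w : List Sym} (φ : Fm V J) (hφ : φ.Proper) {h : Option V → ℕ}
    {o : Aux V J → List Sym} {b : Bool} (hle : ∀ v, h v ≤ w.length) (hnone : h none = 0)
    (htmp : o .tmp = []) (hrow : o .row = []) (hcount : ∀ i, o (.count none i) = [])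
    (hbound : ∀ v ∈ φ.bound, h (some v) = 0 ∧ ∀ i, o (.count (some v) i) = []) :
    Run φ.code b (layout w h o) (φ.time.eval w.length)
      (decide (Holds w (fun j => o (.array j)) (fun v => h (some v)) φ)) (layout w h o) := by
  induction φ generalizing h o b with
  | sym x s =>
    refine Run.cast (Run.test (Stk.right (some x)) (fun a => decide (a = some s)) b (layout w h o))
      ?_ ?_ rfl
    · simp [Fm.time]
    · rw [Bool.eq_iff_iff]; simp only [decide_eq_true_iff]
      simp [Holds]
  | rel j x y =>
    refine Run.cast (run_read_array (x := x) (y := y) (j := j) (b := b) hle hnone htmp hrow)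
      rfl ?_ rfl
    rw [Bool.eq_iff_iff]; simp only [decide_eq_true_iff]
    simp [Holds]
  | le x y =>
    refine Run.cast (run_le (x := x) (y := y) (b := b) hle htmp hcount) rfl ?_ rfl
    rw [Bool.eq_iff_iff]; simp only [decide_eq_true_iff]
    simp [Holds]
  | not φ ih =>
    have := ih hφ (b := b) hle hnone htmp hrow hcount hbound
    refine Run.cast (Run.seq this (.set Bool.not _ _)) ?_ ?_ rfl
    · simp [Fm.time]
    · rw [Bool.eq_iff_iff]; simp only [Bool.not_eq_true', decide_eq_false_iff_not, decide_eq_true_iff]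
      simp [Holds]
  | and φ ψ ih1 ih2 =>
    have h1 := ih1 hφ.1 (b := b) hle hnone htmp hrow hcount fun v hv => hbound v (Or.inl hv)
    have h2 := ih2 hφ.2 (b := true) hle hnone htmp hrow hcount fun v hv => hbound v (Or.inr hv)
    simp only [Fm.time, Polynomial.eval_add, Polynomial.eval_one]
    by_cases hh : Holds w (fun j => o (.array j)) (fun v => h (some v)) φ
    · rw [decide_eq_true hh] at h1
      refine Run.weaken (t := φ.time.eval w.length + (1 + ψ.time.eval w.length)) ?_ (by omega)
      refine Run.cast (Run.seq h1 (.ite_true h2)) rfl ?_ rfl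
      rw [Bool.eq_iff_iff]; simp only [decide_eq_true_iff]
      simp [Holds, hh]
    · rw [decide_eq_false hh] at h1
      refine Run.weaken (t := φ.time.eval w.length + (1 + 1)) ?_ (by omega)
      refine Run.cast (Run.seq h1 (.ite_false (.set id _ _))) rfl ?_ rfl
      rw [Bool.eq_iff_iff]; simp only [decide_eq_true_iff]
      simp [Holds, hh]
  | cle x φ ψ ih1 ih2 =>
    obtain ⟨⟨hx1, hx2⟩, hp1, hp2⟩ := hφ
    have hx := hbound x (by simp [Fm.bound])
    set A : ℕ → Prop := fun i => Holds w (fun j => o (.array j))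
      (Function.update (fun v => h (some v)) x i) φ with hA
    set B : ℕ → Prop := fun i => Holds w (fun j => o (.array j))
      (Function.update (fun v => h (some v)) x i) ψ with hB
    set O : ℕ → ℕ → Aux V J → List Sym := fun a c => Function.update (Function.update o
      (.count (some x) false) (List.replicate a .sep))
      (.count (some x) true) (List.replicate c .sep) with hO
    have g1 : ∀ i < w.length, ∀ a c b, Run φ.code b (layout w (Function.update h (some x) i)
        (O a c)) (φ.time.eval w.length) (decide (A i))
        (layout w (Function.update h (some x) i) (O a c)) := by
      intro i hi a c b
      have := ih1 hp1 (b := b) (h := Function.update h (some x) i) (o := O a c)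
        (update_head_le hle x hi) (by simpa using hnone) (by simpa [hO] using htmp) (by simpa [hO] using hrow)
        (by simpa [hO] using hcount) (by
          intro v hv
          have hvx : v ≠ x := fun e => hx1 (e ▸ hv)
          have := hbound v (by simp [Fm.bound, hv])
          simpa [hO, hvx] using this)
      rw [update_comp_some] at this
      simpa [hO, hA] using this
    have g2 : ∀ i < w.length, ∀ a c b, Run ψ.code b (layout w (Function.update h (some x) i)
        (O a c)) (ψ.time.eval w.length) (decide (B i))
        (layout w (Function.update h (some x) i) (O a c)) := by
      intro i hi a c b
      have := ih2 hp2 (b := b) (h := Function.update h (some x) i) (o := O a c)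
        (update_head_le hle x hi) (by simpa using hnone) (by simpa [hO] using htmp) (by simpa [hO] using hrow)
        (by simpa [hO] using hcount) (by
          intro v hv
          have hvx : v ≠ x := fun e => hx2 (e ▸ hv)
          have := hbound v (by simp [Fm.bound, hv])
          simpa [hO, hvx] using this)
      rw [update_comp_some] at this
      simpa [hO, hB] using this
    have u1 : ∀ i a c (p : Prop) [Decidable p], (if decide p then Function.update
        (layout w (Function.update h (some x) i) (O a c))
        (.aux (.count (some x) false)) (.sep :: layout w (Function.update h (some x) i) (O a c)
        (.aux (.count (some x) false))) else layout w (Function.update h (some x) i) (O a c)) =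
        layout w (Function.update h (some x) i) (O (a + if p then 1 else 0) c) := by
      intro i a c p _
      by_cases hp : p
      · simp only [hp, decide_true, if_true, update_layout_aux, hO]
        rw [Function.update_comm (a := Aux.count (some x) true) (by simp)]
        simp [List.replicate_succ]
      · simp [hp]
    have u2 : ∀ i a c (p : Prop) [Decidable p], (if decide p then Function.update
        (layout w (Function.update h (some x) i) (O a c))
        (.aux (.count (some x) true)) (.sep :: layout w (Function.update h (some x) i) (O a c)
        (.aux (.count (some x) true))) else layout w (Function.update h (some x) i) (O a c)) =
        layout w (Function.update h (some x) i) (O a (c + if p then 1 else 0)) := by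
      intro i a c p _
      by_cases hp : p
      · simp only [hp, decide_true, if_true, update_layout_aux, hO]
        simp [List.replicate_succ]
      · simp [hp]
    have h1 := run_headLoop (some x) (.seq φ.code (.seq (.ite (.push
        (.aux (.count (some x) false)) .sep) (.set id)) (.seq ψ.code (.ite
        (.push (.aux (.count (some x) true)) .sep) (.set id)))))
      (fun i => match i with | 0 => b | i + 1 => decide (B i))
      (fun i => O (Nat.count A i) (Nat.count B i))
      (φ.time.eval w.length + (2 + (ψ.time.eval w.length + 2))) hx.1 (by
        intro i hi
        have r1 := run_count (.aux (.count (some x) false)) (decide (A i))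
          (layout w (Function.update h (some x) i) (O (Nat.count A i) (Nat.count B i)))
        have r2 := run_count (.aux (.count (some x) true)) (decide (B i))
          (layout w (Function.update h (some x) i) (O (Nat.count A (i + 1)) (Nat.count B i)))
        rw [u1, ← Nat.count_succ] at r1
        rw [u2, ← Nat.count_succ] at r2
        exact .seq (g1 i hi _ _ _) (.seq r1 (.seq (g2 i hi _ _ _) r2)))
    have h2 := run_compareCounts (w := w) (some x) (match w.length with
      | 0 => b | i + 1 => decide (B i)) h (O (Nat.count A w.length) (Nat.count B w.length))
      w.length (by simpa [hO] using Nat.count_le _) (by simpa [hO] using Nat.count_le _)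
    have e0 : O (Nat.count A 0) (Nat.count B 0) = o := by
      funext a
      by_cases h2 : a = .count (some x) true
      · subst h2; simp [hO, hx.2]
      · by_cases h3 : a = .count (some x) false
        · subst h3; simp [hO, hx.2]
        · simp [hO, h2, h3]
    have e1 : Function.update (Function.update (O (Nat.count A w.length) (Nat.count B w.length))
        (.count (some x) true) []) (.count (some x) false) [] = o := by
      funext a
      by_cases h2 : a = .count (some x) true
      · subst h2; simp [hO, hx.2]
      · by_cases h3 : a = .count (some x) false
        · subst h3; simp [hO, hx.2]
        · simp [hO, h2, h3]
    rw [e1] at h2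
    rw [e0] at h1
    refine Run.cast (Run.seq h1 h2) ?_ ?_ rfl
    · simp [Fm.time]
    · rw [Bool.eq_iff_iff]; simp only [decide_eq_true_iff]
      simp [hO, Holds, hA, hB]

end Formulas

/-! ### Bounded iteration of definitions -/

section Commands

variable {V J : Type} [DecidableEq V] [DecidableEq J]

/-- Straight-line definitions of relations by formulas, with a loop: `assign j x y φ` redefines
the relation `j` as the set of the pairs `(x, y)` that satisfy `φ`, and `rep x c` runs `c` for all
positions `x` in turn. -/
inductive Cmd (V J : Type) where
  | assign (j : J) (x y : V) (φ : Fm V J)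
  | seq (c d : Cmd V J)
  | rep (x : V) (c : Cmd V J)

open Classical in
/-- The list of bits of a binary relation on the numbers below `n`. -/
noncomputable def table (n : ℕ) (r : ℕ → ℕ → Prop) : List Sym :=
  (List.range n).flatMap fun i => (List.range n).map fun k => Sym.bit (decide (r i k))

lemma length_table (n : ℕ) (r : ℕ → ℕ → Prop) : (table n r).length = n * n := by
  simp [table]

open Classical in
lemma getElem?_table {n : ℕ} (r : ℕ → ℕ → Prop) {i k : ℕ} (hi : i < n) (hk : k < n) :
    (table n r)[n * i + k]? = some (.bit (decide (r i k))) := by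
  have key : ∀ m, i < m → ((List.range m).flatMap fun i => (List.range n).map fun k =>
      Sym.bit (decide (r i k)))[n * i + k]? = some (.bit (decide (r i k))) := by
    intro m
    induction m with
    | zero => intro h; omega
    | succ m ih =>
      intro h
      have hlen : ((List.range m).flatMap fun i => (List.range n).map fun k =>
        Sym.bit (decide (r i k))).length = n * m := by simp [Nat.mul_comm]
      rw [List.range_succ, List.flatMap_append]
      by_cases hm : i < m
      · rw [List.getElem?_append_left, ih hm]
        rw [hlen]
        calc n * i + k < n * (i + 1) := by rw [Nat.mul_succ]; omega
          _ ≤ n * m := Nat.mul_le_mul_left n hm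
      · obtain rfl : i = m := by omega
        rw [List.getElem?_append_right (by omega), hlen, Nat.add_sub_cancel_left]
        simp [hk]
  exact key n hi

namespace Cmd

/-- The relations after a command is run on the word `w`. -/
noncomputable def exec (w : List Sym) : Cmd V J → (V → ℕ) → (J → List Sym) → (J → List Sym)
  | .assign j x y φ, e, ρ => Function.update ρ j (table w.length fun i k =>
      Holds w ρ (Function.update (Function.update e x i) y k) φ)
  | .seq c d, e, ρ => d.exec w e (c.exec w e ρ)
  | .rep x c, e, ρ => Nat.rec ρ (fun i ρ => c.exec w (Function.update e x i) ρ) w.length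

/-- The variables that are bound in a command. -/
def bound : Cmd V J → Set V
  | .assign _ x y φ => {x} ∪ ({y} ∪ φ.bound)
  | .seq c d => c.bound ∪ d.bound
  | .rep x c => {x} ∪ c.bound

/-- No variable is bound again in the scope of its binder. -/
def Proper : Cmd V J → Prop
  | .assign _ x y φ => (x ≠ y ∧ x ∉ φ.bound ∧ y ∉ φ.bound) ∧ φ.Proper
  | .seq c d => c.Proper ∧ d.Proper
  | .rep x c => x ∉ c.bound ∧ c.Proper

/-- The program that runs a command. -/
def code : Cmd V J → Prog (Stk V J) Sym
  | .assign j x y φ => .seq (.headLoop (some x) (.headLoop (some y) (.seq φ.code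
        (.ite (.push (.aux .fresh) (.bit true)) (.push (.aux .fresh) (.bit false))))))
      (.seq (.loop (.aux (.array j)) (.pop (.aux (.array j))))
        (.loop (.aux .fresh) (.move (.aux .fresh) (.aux (.array j)))))
  | .seq c d => .seq c.code d.code
  | .rep x c => .headLoop (some x) c.code

/-- A bound on the number of steps of a command, as a function of the length of the word. -/
noncomputable def time : Cmd V J → Polynomial ℕ
  | .assign _ _ _ φ => (Polynomial.X * ((Polynomial.X * ((φ.time + 2) + 6) + 2) + 6) + 2) +
      ((2 * (Polynomial.X * Polynomial.X) + 1) + (3 * (Polynomial.X * Polynomial.X) + 1))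
  | .seq c d => c.time + d.time
  | .rep _ c => Polynomial.X * (c.time + 6) + 2

end Cmd

/-- The auxiliary stacks between the runs of commands: there are only the arrays. -/
def arrays (ρ : J → List Sym) : Aux V J → List Sym
  | .array j => ρ j
  | _ => []

open Classical in
lemma run_assign {w : List Sym} {h : Option V → ℕ} {ρ : J → List Sym} {b : Bool} {j : J} {x y : V}
    {φ : Fm V J} (hφ : (Cmd.assign j x y φ).Proper) (hle : ∀ v, h v ≤ w.length)
    (hnone : h none = 0) (hρ : ∀ j, (ρ j).length ≤ w.length * w.length)
    (hbound : ∀ v ∈ (Cmd.assign j x y φ).bound, h (some v) = 0) :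
    ∃ b', Run (Cmd.assign j x y φ).code b (layout w h (arrays ρ))
      ((Cmd.assign j x y φ).time.eval w.length) b'
      (layout w h (arrays ((Cmd.assign j x y φ).exec w (fun v => h (some v)) ρ))) := by
  obtain ⟨⟨hxy, hxb, hyb⟩, hp⟩ := hφ
  set n := w.length with hn
  have hx : h (some x) = 0 := hbound x (by simp [Cmd.bound])
  have hy : h (some y) = 0 := hbound y (by simp [Cmd.bound])
  set r : ℕ → ℕ → Prop := fun i k => Holds w ρ (Function.update (Function.update
    (fun v => h (some v)) x i) y k) φ with hr
  set row : ℕ → ℕ → List Sym := fun i m => (List.range m).map fun k => Sym.bit (decide (r i k))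
    with hrow
  set O : List Sym → Aux V J → List Sym := fun l => Function.update (arrays ρ) .fresh l.reverse
    with hO
  -- the bits are collected in reverse on the stack `fresh`; moving them to the array restores the
  -- order
  have hbody : ∀ i < n, ∀ k < n, ∀ l b, Run (.seq φ.code (.ite (.push (.aux .fresh) (.bit true))
      (.push (.aux .fresh) (.bit false)))) b
      (layout w (Function.update (Function.update h (some x) i) (some y) k) (O l))
      (φ.time.eval n + 2) (decide (r i k))
      (layout w (Function.update (Function.update h (some x) i) (some y) k)
        (O (l ++ [.bit (decide (r i k))]))) := by
    intro i hi k hk l b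
    have h1 := Fm.run_code φ hp (w := w) (b := b) (o := O l)
      (h := Function.update (Function.update h (some x) i) (some y) k)
      (fun v => update_head_le (update_head_le hle x hi) y hk v) (by simpa using hnone)
      (by simp [hO, arrays]) (by simp [hO, arrays]) (by simp [hO, arrays]) (by
        intro v hv
        have hvx : v ≠ x := fun e => hxb (e ▸ hv)
        have hvy : v ≠ y := fun e => hyb (e ▸ hv)
        have := hbound v (by simp [Cmd.bound, hv])
        simp [hvx, hvy, this, hO, arrays])
    rw [update_comp_some, update_comp_some] at h1
    have e1 : (fun j => O l (.array j)) = ρ := by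
      funext j; simp [hO, arrays]
    rw [e1] at h1
    change Run φ.code b _ _ (decide (r i k)) _ at h1
    refine Run.seq h1 ?_
    have e2 : ∀ s, Function.update (layout w (Function.update (Function.update h (some x) i)
        (some y) k) (O l)) (.aux .fresh) (s :: layout w (Function.update
        (Function.update h (some x) i) (some y) k) (O l) (.aux .fresh)) =
        layout w (Function.update (Function.update h (some x) i) (some y) k) (O (l ++ [s])) := by
      intro s
      simp [hO]
    by_cases hrk : r i k
    · have := Run.ite_true (d := .push (.aux .fresh) (.bit false)) (Run.push (.aux .fresh)
        (.bit true) true (layout w (Function.update (Function.update h (some x) i) (some y) k)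
        (O l)))
      rw [e2] at this
      simpa [hrk] using this
    · have := Run.ite_false (c := .push (.aux .fresh) (.bit true)) (Run.push (.aux .fresh)
        (.bit false) false (layout w (Function.update (Function.update h (some x) i) (some y) k)
        (O l)))
      rw [e2] at this
      simpa [hrk] using this
  have hinner : ∀ i < n, ∀ l b, Run (.headLoop (some y) (.seq φ.code
      (.ite (.push (.aux .fresh) (.bit true)) (.push (.aux .fresh) (.bit false))))) b
      (layout w (Function.update h (some x) i) (O l)) (n * ((φ.time.eval n + 2) + 6) + 2)
      (if n = 0 then b else decide (r i (n - 1)))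
      (layout w (Function.update h (some x) i) (O (l ++ row i n))) := by
    intro i hi l b
    have := run_headLoop (w := w) (some y) (.seq φ.code
      (.ite (.push (.aux .fresh) (.bit true)) (.push (.aux .fresh) (.bit false))))
      (fun k => if k = 0 then b else decide (r i (k - 1))) (fun k => O (l ++ row i k))
      (φ.time.eval n + 2) (h := Function.update h (some x) i) (by simpa [hxy.symm] using hy) (by
        intro k hk
        have := hbody i hi k hk (l ++ row i k) (if k = 0 then b else decide (r i (k - 1)))
        have e : l ++ row i (k + 1) = l ++ row i k ++ [.bit (decide (r i k))] := by
          simp [hrow, List.range_succ]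
        simpa [e] using this)
    rw [← hn] at this
    simpa only [if_true, hrow, List.range_zero, List.map_nil, List.append_nil] using this
  obtain ⟨B, hB0, hB⟩ : ∃ B : ℕ → Bool, B 0 = b ∧ ∀ i,
      B (i + 1) = (if n = 0 then B i else decide (r i (n - 1))) :=
    ⟨fun i => Nat.rec b (fun i b => if n = 0 then b else decide (r i (n - 1))) i,
      rfl, fun _ => rfl⟩
  have houter := run_headLoop (w := w) (some x) (.headLoop (some y) (.seq φ.code
      (.ite (.push (.aux .fresh) (.bit true)) (.push (.aux .fresh) (.bit false)))))
      B (fun i => O ((List.range i).flatMap fun i => row i n))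
      (n * ((φ.time.eval n + 2) + 6) + 2) (h := h) hx (by
        intro i hi
        have := hinner i hi ((List.range i).flatMap fun i => row i n) (B i)
        rw [hB]
        simpa [List.range_succ] using this)
  rw [hB0, ← hn] at houter
  have e0 : O ((List.range 0).flatMap fun i => row i n) = arrays ρ := by
    funext a
    cases a <;> simp [hO, arrays]
  have e1 : ((List.range n).flatMap fun i => row i n) = table n r := rfl
  rw [e0, e1] at houter
  have h2 := run_clear_stack (.aux (.array j)) (B n) (n * n) (layout w h (O (table n r)))
    (by simpa [hO, arrays] using hρ j)
  rw [update_layout_aux] at h2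
  have h3 := run_move_all (k := Stk.aux (.fresh : Aux V J)) (l := .aux (.array j)) (by simp) (B n)
    (n * n) (layout w h (Function.update (O (table n r)) (.array j) []))
    (by simp [hO, length_table])
  refine ⟨B n, ?_⟩
  refine Run.cast (Run.seq houter (.seq h2 h3)) ?_ rfl ?_
  · simp [Cmd.time]
  · rw [update_layout_aux, update_layout_aux]
    congr 1
    funext a
    cases a with
    | array j' =>
      by_cases hj : j' = j
      · subst hj; simp [arrays, Cmd.exec, hO, hr, ← hn]
      · simp [arrays, Cmd.exec, hO, hj]
    | _ => simp [arrays, hO]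

lemma Cmd.length_exec_le (w : List Sym) (c : Cmd V J) (e : V → ℕ) (ρ : J → List Sym)
    (hρ : ∀ j, (ρ j).length ≤ w.length * w.length) (j : J) :
    (c.exec w e ρ j).length ≤ w.length * w.length := by
  induction c generalizing e ρ j with
  | assign j' x y φ =>
    unfold Cmd.exec
    by_cases hj : j = j'
    · subst hj; simp [length_table]
    · simpa [hj] using hρ j
  | seq c d ih1 ih2 => exact ih2 _ _ (fun j => ih1 _ _ hρ j) j
  | rep x c ih =>
    have : ∀ m, ∀ j, ((Nat.rec ρ (fun i ρ => c.exec w (Function.update e x i) ρ) m :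
        J → List Sym) j).length ≤ w.length * w.length := by
      intro m
      induction m with
      | zero => exact hρ
      | succ m ihm => exact fun j => ih _ _ ihm j
    exact this _ j

/-- The program of a command computes the arrays of the relations that the command defines. -/
theorem Cmd.run_code {w : List Sym} (c : Cmd V J) (hc : c.Proper) {h : Option V → ℕ}
    {ρ : J → List Sym} (b : Bool) (hle : ∀ v, h v ≤ w.length) (hnone : h none = 0)
    (hρ : ∀ j, (ρ j).length ≤ w.length * w.length) (hbound : ∀ v ∈ c.bound, h (some v) = 0) :
    ∃ b', Run c.code b (layout w h (arrays ρ)) (c.time.eval w.length) b'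
      (layout w h (arrays (c.exec w (fun v => h (some v)) ρ))) := by
  induction c generalizing h ρ b with
  | assign j x y φ => exact run_assign hc hle hnone hρ hbound
  | seq c d ih1 ih2 =>
    obtain ⟨b1, h1⟩ := ih1 hc.1 b hle hnone hρ fun v hv => hbound v (Or.inl hv)
    obtain ⟨b2, h2⟩ := ih2 hc.2 b1 hle hnone (fun j => c.length_exec_le w _ ρ hρ j)
      fun v hv => hbound v (Or.inr hv)
    refine ⟨b2, ?_⟩
    have := Run.seq h1 h2
    simpa [Cmd.time, Cmd.exec, Cmd.code] using this
  | rep x c ih =>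
    obtain ⟨hx, hp⟩ := hc
    set R : ℕ → J → List Sym := fun i => Nat.rec ρ
      (fun i ρ => c.exec w (Function.update (fun v => h (some v)) x i) ρ) i with hR
    have hRlen : ∀ i j, (R i j).length ≤ w.length * w.length := by
      intro i
      induction i with
      | zero => exact hρ
      | succ i ihi => exact fun j => c.length_exec_le w _ _ ihi j
    have step : ∀ i b, ∃ b', i < w.length → Run c.code b
        (layout w (Function.update h (some x) i) (arrays (R i))) (c.time.eval w.length) b'
        (layout w (Function.update h (some x) i) (arrays (R (i + 1)))) := by
      intro i b
      by_cases hi : i < w.length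
      · obtain ⟨b', hb'⟩ := ih hp (ρ := R i) b (update_head_le hle x hi) (by simpa using hnone)
          (hRlen i) (by
            intro v hv
            have hvx : v ≠ x := fun e => hx (e ▸ hv)
            have := hbound v (by simp [Cmd.bound, hv])
            simpa [hvx] using this)
        rw [update_comp_some] at hb'
        exact ⟨b', fun _ => hb'⟩
      · exact ⟨b, fun h => absurd h hi⟩
    choose F hF using step
    set B : ℕ → Bool := fun i => Nat.rec b (fun i b => F i b) i with hB
    have := run_headLoop (w := w) (some x) c.code B (fun i => arrays (R i)) (c.time.eval w.length)
      (h := h) (hbound x (by simp [Cmd.bound])) (fun i hi => hF i (B i) hi)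
    exact ⟨B w.length, Run.cast this (by simp [Cmd.time]) rfl rfl⟩

/-! ### Decision procedures given by formulas -/

/-- Push the top of the stack `right none` on the left parts of the heads in a list. -/
def Prog.spread : List V → Prog (Stk V J) Sym
  | [] => .set id
  | v :: l => .seq (.copy (.right none) (.left (some v))) (spread l)

/-- Move the heads in a list from the end of the word to its start. -/
def Prog.rewind : List V → Prog (Stk V J) Sym
  | [] => .set id
  | v :: l => .seq (.loop (.left (some v)) (.move (.left (some v)) (.right (some v)))) (rewind l)

/-- Copy the input word from the extra head to all heads. -/
def Prog.setup (l : List V) : Prog (Stk V J) Sym :=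
  .seq (.loop (.right none) (.seq (.spread l) (.move (.right none) (.left none))))
    (.seq (.rewind l) (.loop (.left none) (.move (.left none) (.right none))))

/-- The stacks while the input word is distributed: its first `i` symbols are on the left parts
of all heads, and the others are on the right part of the extra head. -/
def partialStacks (w : List Sym) (i : ℕ) : Stk V J → List Sym
  | .left _ => (w.take i).reverse
  | .right none => w.drop i
  | _ => []

lemma run_spread (l : List V) (hl : l.Nodup) (b : Bool) (S : Stk V J → List Sym) {a : Sym}
    {t : List Sym} (hS : S (.right none) = a :: t) :
    Run (.spread l) b S (l.length + 1) b (fun k => match k with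
      | .left (some v) => if v ∈ l then a :: S (.left (some v)) else S (.left (some v))
      | k => S k) := by
  induction l generalizing S with
  | nil =>
    refine Run.weaken (t := 1) ?_ (by simp)
    refine Run.cast (Run.set id b S) rfl rfl ?_
    funext k
    rcases k with (_ | v) | v | a <;> simp
  | cons v l ih =>
    have h1 := Run.copy (.right none) (.left (some v)) b S
    have h2 := ih hl.of_cons (copyTop S (.right none) (.left (some v)))
      (by simp [copyTop, hS])
    refine Run.weaken (t := 1 + (l.length + 1)) ?_ (by simp; omega)
    refine Run.cast (Run.seq h1 h2) rfl rfl ?_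
    funext k
    rcases k with (_ | u) | u | a
    · simp [copyTop, hS]
    · by_cases hu : u = v
      · subst hu
        simp [copyTop, hS, (List.nodup_cons.1 hl).1]
      · simp [copyTop, hS, hu]
    · simp [copyTop, hS]
    · simp [copyTop, hS]

lemma run_rewind (l : List V) (hl : l.Nodup) (b : Bool) (w : List Sym) (h : Option V → ℕ)
    (o : Aux V J → List Sym) :
    Run (.rewind l) b (layout w h o) (l.length * (3 * w.length + 1) + 1) b
      (layout w (fun v => if v ∈ l.map some then 0 else h v) o) := by
  induction l generalizing h with
  | nil => exact Run.cast (Run.set id b (layout w h o)) (by simp) rfl (by simp)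
  | cons v l ih =>
    have h1 := run_move_all (k := Stk.left (some v)) (l := .right (some v)) (by simp) b w.length
      (layout w h o) (by simp)
    have e : Function.update (Function.update (layout w h o) (.left (some v)) [])
        (.right (some v)) ((layout w h o (.left (some v))).reverse ++
          layout w h o (.right (some v))) = layout w (Function.update h (some v) 0) o := by
      funext k
      rcases k with u | u | a
      · by_cases hu : u = some v
        · subst hu; simp
        · simp [hu]
      · by_cases hu : u = some v
        · subst hu; simp
        · simp [hu]
      · simp
    rw [e] at h1
    have h2 := ih hl.of_cons (Function.update h (some v) 0)
    refine Run.weaken (t := (3 * w.length + 1) + (l.length * (3 * w.length + 1) + 1)) ?_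
      (by rw [List.length_cons, Nat.add_mul]; omega)
    refine Run.cast (Run.seq h1 h2) rfl rfl ?_
    congr 1
    funext u
    by_cases hu : u = some v
    · subst hu; simp
    · simp [hu]

lemma run_setup (l : List V) (hl : l.Nodup) (hmem : ∀ v, v ∈ l) (b : Bool) (w : List Sym) :
    Run (.setup l) b (Function.update (fun _ => []) (.right none) w)
      ((w.length * (l.length + 4) + 1) + ((l.length * (3 * w.length + 1) + 1) +
        (3 * w.length + 1))) b
      (layout w (fun _ => 0) (arrays (fun _ : J => []))) := by
  have key : ∀ m i, i + m = w.length → Run (.loop (.right none) (.seq (.spread l)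
      (.move (.right none) (.left none)))) b (partialStacks w i) (m * (l.length + 4) + 1) b
      (partialStacks w w.length : Stk V J → List Sym) := by
    intro m
    induction m with
    | zero =>
      intro i hi
      obtain rfl : i = w.length := by omega
      exact Run.weaken (.loop_nil (by simp [partialStacks])) (by omega)
    | succ m ih =>
      intro i hi
      have hi' : i < w.length := by omega
      have hd : w.drop i = w[i] :: w.drop (i + 1) := List.drop_eq_getElem_cons hi'
      have h1 := run_spread l hl b (partialStacks w i : Stk V J → List Sym) (a := w[i])
        (t := w.drop (i + 1)) hd
      have h2 := run_move (k := Stk.right none) (l := Stk.left none) (by simp) b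
        (fun k => match k with
        | .left (some v) => if v ∈ l then w[i] :: (partialStacks w i : Stk V J → List Sym)
            (.left (some v)) else (partialStacks w i : Stk V J → List Sym) (.left (some v))
        | k => (partialStacks w i : Stk V J → List Sym) k)
      refine Run.weaken (.loop_cons (by simp [partialStacks]; omega) (.seq h1 h2)
        (t' := m * (l.length + 4) + 1) ?_)
        (by rw [Nat.add_mul]; omega)
      convert ih (i + 1) (by omega) using 1
      have e : (w.take (i + 1)).reverse = w[i] :: (w.take i).reverse := by
        rw [← List.take_append_getElem hi', List.reverse_append]
        rfl
      simp only [moveTop, partialStacks, hd]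
      funext k
      rcases k with (_ | u) | (_ | u) | a
      · simp [partialStacks, -List.take_append_getElem, e]
      · simp [partialStacks, hmem, -List.take_append_getElem, e]
      · simp [partialStacks]
      · simp [partialStacks]
      · simp [partialStacks]
  have h1 := key w.length 0 (by omega)
  have e1 : (partialStacks w 0 : Stk V J → List Sym) =
      Function.update (fun _ => []) (.right none) w := by
    funext k
    rcases k with (_ | u) | (_ | u) | a <;> simp [partialStacks]
  have e2 : (partialStacks w w.length : Stk V J → List Sym) =
      layout w (fun _ => w.length) (arrays (fun _ : J => [])) := by
    funext k
    rcases k with (_ | u) | (_ | u) | (a | _ | _ | _ | _) <;> simp [partialStacks, arrays]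
  rw [e1, e2] at h1
  have h2 := run_rewind l hl b w (fun _ => w.length) (arrays (V := V) (fun _ : J => []))
  have h3 := run_move_all (k := Stk.left none) (l := .right none) (by simp) b w.length
    (layout w (fun v => if v ∈ l.map some then 0 else w.length)
      (arrays (V := V) (fun _ : J => []))) (by simp)
  refine Run.seq h1 (.seq h2 ?_)
  convert h3 using 1
  funext k
  rcases k with (_ | u) | (_ | u) | a <;> simp [hmem]

open Classical in
/-- A problem that is decided by a sequence of definitions and a final formula is decidable in
polynomial time. -/
theorem decidableInPolyTime_of_holds [Fintype V] [Fintype J] {α : Type} (enc : α → List Sym)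
    (Q : α → Prop) (c : Cmd V J) (φ : Fm V J) (hc : c.Proper) (hφ : φ.Proper)
    (h : ∀ a, Holds (enc a) (c.exec (enc a) (fun _ => 0) (fun _ => [])) (fun _ => 0) φ ↔ Q a) :
    DecidableInPolyTime enc Q := by
  have : Inhabited Sym := ⟨.sep⟩
  refine decidableInPolyTime_of_run enc Q
    (.seq (.setup (Finset.univ : Finset V).toList) (.seq c.code φ.code)) (.right none)
    (((Polynomial.X * ((Fintype.card V : Polynomial ℕ) + 4) + 1) +
      (((Fintype.card V : Polynomial ℕ) * (3 * Polynomial.X + 1) + 1) +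
        (3 * Polynomial.X + 1))) + (c.time + φ.time)) fun a => ?_
  have h1 := run_setup (J := J) (Finset.univ : Finset V).toList (Finset.nodup_toList _)
    (by simp) false (enc a)
  obtain ⟨b, h2⟩ := c.run_code hc (w := enc a) (h := fun _ => 0) (ρ := fun _ => []) false
    (by simp) rfl (by simp) (by simp)
  have h3 := φ.run_code hφ (w := enc a) (h := fun _ => 0)
    (o := arrays (c.exec (enc a) (fun _ => 0) (fun _ => []))) (b := b)
    (by simp) rfl rfl rfl (fun _ => rfl) (fun _ _ => ⟨rfl, fun _ => rfl⟩)
  refine ⟨_, ?_, _, Run.cast (Run.seq h1 (.seq h2 h3)) ?_ rfl rfl⟩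
  · rw [decide_eq_true_iff]
    exact h a
  · simp

end Commands

/-! ### Indistinguishable individuals -/

section Equivalence

variable {𝔻 : FeatureDomains}

/-- The description logic with inverse roles if `inv` is true and with feature comparisons if
`feat` is true, as its set of concepts. -/
def Logic (𝔻 : FeatureDomains) (inv feat : Bool) : Set (Concept 𝔻) :=
  {C | (inv = false → C.InverseFree) ∧ (feat = false → C.FeatureFree)}

/-- The roles that the logic allows. -/
def Role.Allowed (inv : Bool) : Role → Prop
  | .name _ => True
  | .inv _ => inv = true

variable {I : Database 𝔻} {inv feat : Bool}

lemma top_mem_Logic : (.top : Concept 𝔻) ∈ Logic 𝔻 inv feat := ⟨fun _ => trivial, fun _ => trivial⟩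

lemma neg_mem_Logic {C : Concept 𝔻} (h : C ∈ Logic 𝔻 inv feat) : C.neg ∈ Logic 𝔻 inv feat := h

lemma inter_mem_Logic {C D : Concept 𝔻} (h : C ∈ Logic 𝔻 inv feat) (h' : D ∈ Logic 𝔻 inv feat) :
    C.inter D ∈ Logic 𝔻 inv feat :=
  ⟨fun e => ⟨h.1 e, h'.1 e⟩, fun e => ⟨h.2 e, h'.2 e⟩⟩

lemma number_mem_Logic_iff {c : Cmp} {n : ℕ} {R : Role} {C : Concept 𝔻} :
    C.number c n R ∈ Logic 𝔻 inv feat ↔ R.Allowed inv ∧ C ∈ Logic 𝔻 inv feat := by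
  cases R <;> cases inv <;> simp [Logic, Role.Allowed, Concept.InverseFree, Concept.FeatureFree]

lemma Database.finite_adom (I : Database 𝔻) : I.adom.Finite := by
  have : I.adom = ⋃ φ ∈ I.facts, φ.inds := by
    ext a; simp [Database.adom]
  rw [this]
  refine Set.Finite.biUnion I.facts.finite_toSet fun φ _ => ?_
  cases φ <;> simp [DBFact.inds]

lemma Database.succ_subset_adom (I : Database 𝔻) (R : Role) (a : IndName) :
    I.succ R a ⊆ I.adom := by
  intro b hb
  cases R <;> exact ⟨_, hb, by simp [DBFact.inds]⟩

lemma Database.finite_succ (I : Database 𝔻) (R : Role) (a : IndName) : (I.succ R a).Finite :=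
  I.finite_adom.subset (I.succ_subset_adom R a)

/-- The two individuals belong to the same concepts of the logic. -/
def Indist (I : Database 𝔻) (inv feat : Bool) (a b : IndName) : Prop :=
  ∀ C ∈ Logic 𝔻 inv feat, a ∈ I.ext C ↔ b ∈ I.ext C

lemma exists_concept_forall {ι : Type} {s : Set ι} (hs : s.Finite) (F : ι → Concept 𝔻)
    (hF : ∀ i ∈ s, F i ∈ Logic 𝔻 inv feat) :
    ∃ C ∈ Logic 𝔻 inv feat, I.ext C = {x ∈ I.adom | ∀ i ∈ s, x ∈ I.ext (F i)} := by
  induction s, hs using Set.Finite.induction_on with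
  | empty => exact ⟨.top, top_mem_Logic, by simp [Database.ext]⟩
  | @insert i s _ _ ih =>
    obtain ⟨C, hC, e⟩ := ih fun j hj => hF j (Set.mem_insert_of_mem i hj)
    refine ⟨(F i).inter C, inter_mem_Logic (hF i (Set.mem_insert i s)) hC, ?_⟩
    ext x
    simp only [Database.ext, e, Set.mem_inter_iff, Set.mem_ofPred_eq, Set.forall_mem_insert]
    tauto

lemma exists_concept_exists {ι : Type} {s : Set ι} (hs : s.Finite) (F : ι → Concept 𝔻)
    (hF : ∀ i ∈ s, F i ∈ Logic 𝔻 inv feat) :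
    ∃ C ∈ Logic 𝔻 inv feat, I.ext C = {x ∈ I.adom | ∃ i ∈ s, x ∈ I.ext (F i)} := by
  obtain ⟨C, hC, e⟩ := exists_concept_forall (I := I) hs (fun i => (F i).neg)
    fun i hi => neg_mem_Logic (hF i hi)
  refine ⟨C.neg, neg_mem_Logic hC, ?_⟩
  ext x
  simp only [Database.ext, e, Set.mem_sdiff, Set.mem_ofPred_eq]
  grind

/-- Every set of individuals that is closed under indistinguishability is the extension of a
concept: a finite union of finite intersections of concepts that separate its elements from the
other individuals. -/
lemma exists_concept_ext_eq {U : Set IndName} (hU : U ⊆ I.adom)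
    (h : ∀ a ∈ U, ∀ b ∈ I.adom, Indist I inv feat a b → b ∈ U) :
    ∃ C ∈ Logic 𝔻 inv feat, I.ext C = U := by
  have sep : ∀ a b, ∃ C ∈ Logic 𝔻 inv feat, a ∈ U → b ∈ I.adom \ U →
      a ∈ I.ext C ∧ b ∉ I.ext C := by
    intro a b
    by_cases hab : a ∈ U ∧ b ∈ I.adom \ U
    · obtain ⟨ha, hb⟩ := hab
      have hn : ¬ Indist I inv feat a b := fun e => hb.2 (h a ha b hb.1 e)
      unfold Indist at hn
      push Not at hn
      obtain ⟨C, hC, hd⟩ := hn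
      rcases hd with hd | hd
      · exact ⟨C, hC, fun _ _ => hd⟩
      · exact ⟨C.neg, neg_mem_Logic hC, fun _ _ => ⟨⟨hU ha, hd.1⟩, fun e => e.2 hd.2⟩⟩
    · exact ⟨.top, top_mem_Logic, fun ha hb => absurd ⟨ha, hb⟩ hab⟩
  choose F hF hsep using sep
  have h1 : ∀ a, ∃ C ∈ Logic 𝔻 inv feat,
      I.ext C = {x ∈ I.adom | ∀ b ∈ I.adom \ U, x ∈ I.ext (F a b)} := fun a =>
    exists_concept_forall (I.finite_adom.subset Set.sdiff_subset) (F a) fun b _ => hF a b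
  choose G hG hGe using h1
  obtain ⟨C, hC, e⟩ := exists_concept_exists (I := I) (I.finite_adom.subset hU) G
    fun a _ => hG a
  refine ⟨C, hC, ?_⟩
  rw [e]
  ext x
  simp only [hGe, Set.mem_ofPred_eq]
  constructor
  · rintro ⟨hx, a, ha, -, hb⟩
    by_contra hxU
    exact (hsep a x ha ⟨hx, hxU⟩).2 (hb x ⟨hx, hxU⟩)
  · intro hx
    exact ⟨hU hx, x, hx, hU hx, fun b hb => (hsep x b hx hb).1⟩

/-- There is a fitting concept iff no positive example is indistinguishable from a negative
example. -/
theorem hasFitting_iff (x : FittingInput 𝔻) :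
    HasFitting (Logic 𝔻 inv feat) x ↔ ∀ a ∈ x.P, ∀ b ∈ x.N, ¬ Indist x.I inv feat a b := by
  constructor
  · rintro ⟨C, hC, hP, hN⟩ a ha b hb hab
    exact hN b hb ((hab C hC).1 (hP a ha))
  · intro h
    obtain ⟨C, hC, e⟩ := exists_concept_ext_eq (I := x.I) (inv := inv) (feat := feat)
      (U := {b ∈ x.I.adom | ∃ a ∈ x.P, Indist x.I inv feat a b}) (fun b hb => hb.1) (by
        rintro b ⟨_, a, ha, hab⟩ c hc hbc
        exact ⟨hc, a, ha, fun C hC => (hab C hC).trans (hbc C hC)⟩)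
    refine ⟨C, hC, fun a ha => ?_, fun b hb hb' => ?_⟩
    · rw [e]
      exact ⟨x.P_subset a ha, a, ha, fun _ _ => Iff.rfl⟩
    · rw [e] at hb'
      obtain ⟨_, a, ha, hab⟩ := hb'
      exact h a ha b hb hab

/-! ### Partition refinement -/

/-- The `i`-th approximation of indistinguishability. Two individuals are related at stage `0` if
they have the same concept names and feature values, and at stage `i + 1` if they are related at
stage `i` and have, for every role, equally many successors in each class of stage `i`. -/
def Sim (I : Database 𝔻) (inv feat : Bool) : ℕ → IndName → IndName → Prop
  | 0, a, b => (∀ A, DBFact.concept A a ∈ I.facts ↔ DBFact.concept A b ∈ I.facts) ∧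
      (feat = true → ∀ f v, DBFact.feature f a v ∈ I.facts ↔ DBFact.feature f b v ∈ I.facts)
  | i + 1, a, b => Sim I inv feat i a b ∧ ∀ R, R.Allowed inv → ∀ c,
      (I.succ R a ∩ {z | Sim I inv feat i z c}).ncard =
        (I.succ R b ∩ {z | Sim I inv feat i z c}).ncard

lemma Sim.refl (i : ℕ) (a : IndName) : Sim I inv feat i a a := by
  induction i with
  | zero => exact ⟨fun _ => Iff.rfl, fun _ _ _ => Iff.rfl⟩
  | succ i ih => exact ⟨ih, fun _ _ _ => rfl⟩

lemma Sim.symm {i : ℕ} {a b : IndName} (h : Sim I inv feat i a b) : Sim I inv feat i b a := by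
  induction i with
  | zero => exact ⟨fun A => (h.1 A).symm, fun e f v => (h.2 e f v).symm⟩
  | succ i ih => exact ⟨ih h.1, fun R hR c => (h.2 R hR c).symm⟩

lemma Sim.trans {i : ℕ} {a b c : IndName} (h : Sim I inv feat i a b) (h' : Sim I inv feat i b c) :
    Sim I inv feat i a c := by
  induction i with
  | zero => exact ⟨fun A => (h.1 A).trans (h'.1 A), fun e f v => (h.2 e f v).trans (h'.2 e f v)⟩
  | succ i ih => exact ⟨ih h.1 h'.1, fun R hR c => (h.2 R hR c).trans (h'.2 R hR c)⟩

/-- It suffices to count the successors in the classes of the elements of the database. -/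
lemma sim_succ_iff {D : Set IndName} (hD : I.adom ⊆ D) {i : ℕ} {a b : IndName} :
    Sim I inv feat (i + 1) a b ↔ Sim I inv feat i a b ∧ ∀ R, R.Allowed inv → ∀ c ∈ D,
      (I.succ R a ∩ {z | Sim I inv feat i z c}).ncard =
        (I.succ R b ∩ {z | Sim I inv feat i z c}).ncard := by
  refine ⟨fun h => ⟨h.1, fun R hR c _ => h.2 R hR c⟩, fun h => ⟨h.1, fun R hR c => ?_⟩⟩
  by_cases hc : ∃ z ∈ I.adom, Sim I inv feat i z c
  · obtain ⟨z, hz, hzc⟩ := hc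
    have e : {y | Sim I inv feat i y c} = {y | Sim I inv feat i y z} :=
      Set.ext fun y => ⟨fun h => h.trans hzc.symm, fun h => h.trans hzc⟩
    rw [e]
    exact h.2 R hR z (hD hz)
  · have e : ∀ d, I.succ R d ∩ {z | Sim I inv feat i z c} = ∅ := fun d =>
      Set.eq_empty_of_forall_notMem fun z hz => hc ⟨z, I.succ_subset_adom R d hz.1, hz.2⟩
    rw [e, e]

/-- Every class of a stage of `Sim` is the extension of a concept, and number restrictions with this
concept determine how many successors belong to it. -/
lemma Indist.sim {a b : IndName} (h : Indist I inv feat a b) (ha : a ∈ I.adom) (hb : b ∈ I.adom)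
    (i : ℕ) : Sim I inv feat i a b := by
  induction i generalizing a b with
  | zero =>
    refine ⟨fun A => h (.atom A) ⟨fun _ => trivial, fun _ => trivial⟩, fun hf => ?_⟩
    have key : ∀ {a b : IndName}, Indist I inv feat a b → ∀ f v,
        DBFact.feature f a v ∈ I.facts → DBFact.feature f b v ∈ I.facts := by
      intro a b hab f v hv
      have ha : a ∈ I.adom := ⟨_, hv, by simp [DBFact.inds]⟩
      have hmem : ∀ c, (Concept.feature f c v : Concept 𝔻) ∈ Logic 𝔻 inv feat := fun c =>
        ⟨fun _ => trivial, fun e => by simp [e] at hf⟩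
      -- since features are functional, `f ≤ v` and `f ≥ v` together say that the value is `v`
      obtain ⟨_, v1, h1, h1'⟩ := (hab _ (hmem .le)).1 ⟨ha, v, hv, le_refl v⟩
      obtain ⟨_, v2, h2, h2'⟩ := (hab _ (hmem .ge)).1 ⟨ha, v, hv, le_refl v⟩
      obtain rfl := I.functional f b v1 v2 h1 h2
      rwa [le_antisymm h2' h1']
    exact fun f v => ⟨key h f v, key (fun C hC => (h C hC).symm) f v⟩
  | succ i ih =>
    refine ⟨ih h ha hb, fun R hR c => ?_⟩
    obtain ⟨C, hC, e⟩ := exists_concept_ext_eq (I := I) (inv := inv) (feat := feat)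
      (U := {z ∈ I.adom | Sim I inv feat i z c}) (fun z hz => hz.1)
      (fun z hz y hy hzy => ⟨hy, (ih hzy hz.1 hy).symm.trans hz.2⟩)
    have e' : ∀ d, I.succ R d ∩ {z | Sim I inv feat i z c} = I.succ R d ∩ I.ext C := by
      intro d
      rw [e]
      ext z
      constructor
      · exact fun hz => ⟨hz.1, I.succ_subset_adom R d hz.1, hz.2⟩
      · exact fun hz => ⟨hz.1, hz.2.2⟩
    rw [e', e']
    have h1 := (h (.number .le (I.succ R b ∩ I.ext C).ncard R C)
      (number_mem_Logic_iff.2 ⟨hR, hC⟩)).2 ⟨hb, le_refl _⟩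
    have h2 := (h (.number .ge (I.succ R b ∩ I.ext C).ncard R C)
      (number_mem_Logic_iff.2 ⟨hR, hC⟩)).2 ⟨hb, le_refl _⟩
    exact le_antisymm h1.2 h2.2

/-- If two finite sets have equally many elements in each class of an equivalence relation, they
have equally many elements in each union of classes. -/
lemma ncard_inter_eq_of_forall_class {α : Type} (r : Setoid α) {X Y U : Set α} (hX : X.Finite)
    (hY : Y.Finite) (hU : ∀ x y, x ∈ X ∪ Y → y ∈ X ∪ Y → r x y → x ∈ U → y ∈ U)
    (h : ∀ c, (X ∩ {z | r z c}).ncard = (Y ∩ {z | r z c}).ncard) :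
    (X ∩ U).ncard = (Y ∩ U).ncard := by
  classical
  lift X to Finset α using hX
  lift Y to Finset α using hY
  have hf : ∀ (Z : Finset α) (W : Set α), ((Z : Set α) ∩ W).ncard = (Z.filter (· ∈ W)).card := by
    intro Z W
    rw [← Set.ncard_coe_finset]
    congr 1
    ext z; simp
  simp only [hf] at h ⊢
  set T := ((X ∪ Y).filter (· ∈ U)).image (fun z => (⟦z⟧ : Quotient r)) with hT
  have hsum : ∀ Z : Finset α, Z ⊆ X ∪ Y → (Z.filter (· ∈ U)).card =
      ∑ k ∈ T, ((Z.filter (· ∈ U)).filter fun z => (⟦z⟧ : Quotient r) = k).card := by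
    intro Z hZ
    apply Finset.card_eq_sum_card_fiberwise
    intro z hz
    simp only [Finset.coe_filter, Set.mem_ofPred_eq] at hz
    simp only [hT, Finset.coe_image, Set.mem_image, Finset.coe_filter, Set.mem_ofPred_eq]
    exact ⟨z, ⟨hZ hz.1, hz.2⟩, rfl⟩
  rw [hsum X Finset.subset_union_left, hsum Y Finset.subset_union_right]
  refine Finset.sum_congr rfl fun k hk => ?_
  obtain ⟨c, hc, rfl⟩ := Finset.mem_image.1 hk
  rw [Finset.mem_filter] at hc
  have hcl : ∀ Z : Finset α, Z ⊆ X ∪ Y → ((Z.filter (· ∈ U)).filter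
      fun z => (⟦z⟧ : Quotient r) = ⟦c⟧) = Z.filter (· ∈ {z | r z c}) := by
    intro Z hZ
    ext z
    simp only [Finset.mem_filter, Set.mem_ofPred_eq, Quotient.eq]
    constructor
    · exact fun hz => ⟨hz.1.1, hz.2⟩
    · intro hz
      exact ⟨⟨hz.1, hU c z (by simpa using hc.1) (by simpa using hZ hz.1) (r.symm hz.2) hc.2⟩,
        hz.2⟩
  rw [hcl X Finset.subset_union_left, hcl Y Finset.subset_union_right]
  exact h c

/-- A stable stage of `Sim` is contained in indistinguishability: by induction on the concept, every
extension is a union of classes. -/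
lemma Sim.indist {m : ℕ} (hm : ∀ a ∈ I.adom, ∀ b ∈ I.adom, Sim I inv feat m a b →
    Sim I inv feat (m + 1) a b) {a b : IndName} (ha : a ∈ I.adom) (hb : b ∈ I.adom)
    (h : Sim I inv feat m a b) : Indist I inv feat a b := by
  have h0 : ∀ {i} {a b : IndName}, Sim I inv feat i a b → Sim I inv feat 0 a b := by
    intro i
    induction i with
    | zero => exact fun h => h
    | succ i ih => exact fun h => ih h.1
  suffices key : ∀ C ∈ Logic 𝔻 inv feat, ∀ a ∈ I.adom, ∀ b ∈ I.adom, Sim I inv feat m a b →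
      a ∈ I.ext C → b ∈ I.ext C from
    fun C hC => ⟨key C hC a ha b hb h, key C hC b hb a ha h.symm⟩
  intro C
  induction C with
  | top => exact fun _ a _ b hb _ _ => hb
  | atom A => exact fun _ a _ b _ h => ((h0 h).1 A).1
  | neg C ih => exact fun hC a ha b hb h hx => ⟨hb, fun e => hx.2 (ih hC b hb a ha h.symm e)⟩
  | inter C D ihC ihD =>
    exact fun hC a ha b hb h hx =>
      ⟨ihC ⟨fun e => (hC.1 e).1, fun e => (hC.2 e).1⟩ a ha b hb h hx.1,
        ihD ⟨fun e => (hC.1 e).2, fun e => (hC.2 e).2⟩ a ha b hb h hx.2⟩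
  | number c n R C ih =>
    intro hC a ha b hb h hx
    obtain ⟨hR, hC⟩ := number_mem_Logic_iff.1 hC
    have e := ncard_inter_eq_of_forall_class
      ⟨Sim I inv feat m, ⟨Sim.refl m, Sim.symm, Sim.trans⟩⟩ (U := I.ext C) (I.finite_succ R a)
      (I.finite_succ R b) (fun x y hx hy hxy hxU => ih hC x
        (hx.elim (fun h => I.succ_subset_adom R a h) fun h => I.succ_subset_adom R b h) y
        (hy.elim (fun h => I.succ_subset_adom R a h) fun h => I.succ_subset_adom R b h) hxy hxU)
      ((hm a ha b hb h).2 R hR)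
    refine ⟨hb, ?_⟩
    rw [← e]
    exact hx.2
  | feature f c v =>
    intro hC a _ b hb h hx
    have hf : feat = true := by
      by_contra e
      exact hC.2 (by simpa using e)
    obtain ⟨_, v', hv, hv'⟩ := hx
    exact ⟨hb, v', ((h0 h).2 hf f v').1 hv, hv'⟩

/-- A decreasing sequence of finite sets that is constant from its first repetition on is constant
after as many steps as its first set has elements. -/
lemma eq_succ_of_antitone {α : Type} (A : ℕ → Finset α) (hA : ∀ i, A (i + 1) ⊆ A i)
    (h : ∀ i, A (i + 1) = A i → A (i + 2) = A (i + 1)) {m : ℕ} (hm : (A 0).card ≤ m) :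
    A (m + 1) = A m := by
  by_contra hne
  have hne' : ∀ i ≤ m, A (i + 1) ≠ A i := by
    intro i hi e
    have : ∀ k, A (i + k + 1) = A (i + k) := by
      intro k
      induction k with
      | zero => exact e
      | succ k ih => exact h _ ih
    have := this (m - i)
    rw [show i + (m - i) = m by omega] at this
    exact hne this
  have hcard : ∀ i ≤ m + 1, (A i).card + i ≤ (A 0).card := by
    intro i
    induction i with
    | zero => intro _; simp
    | succ i ih =>
      intro hi
      have h1 := ih (by omega)
      have h2 := Finset.card_lt_card ((hA i).ssubset_of_ne (hne' i (by omega)))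
      omega
  have := hcard (m + 1) le_rfl
  omega

/-- Indistinguishability is reached after as many stages as there are pairs of individuals, because
every stage before the stable one loses a pair. -/
theorem indist_iff_sim {m : ℕ} (hm : I.adom.ncard * I.adom.ncard ≤ m) {a b : IndName}
    (ha : a ∈ I.adom) (hb : b ∈ I.adom) : Indist I inv feat a b ↔ Sim I inv feat m a b := by
  classical
  refine ⟨fun h => h.sim ha hb m, fun h => ?_⟩
  set D := I.finite_adom.toFinset with hD
  set A : ℕ → Finset (IndName × IndName) := fun i =>
    (D ×ˢ D).filter fun p => Sim I inv feat i p.1 p.2 with hA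
  have hcard : (A 0).card ≤ m := by
    refine (Finset.card_filter_le _ _).trans ?_
    rw [Finset.card_product, hD, ← Set.ncard_eq_toFinset_card _ I.finite_adom]
    exact hm
  have hmem : ∀ i a b, (a, b) ∈ A i ↔ (a ∈ I.adom ∧ b ∈ I.adom) ∧ Sim I inv feat i a b := by
    intro i a b; simp [hA, hD]
  have hst := eq_succ_of_antitone A (fun i p hp => by
      obtain ⟨a, b⟩ := p
      rw [hmem] at hp ⊢
      exact ⟨hp.1, hp.2.1⟩) (fun i e => by
      have e' : ∀ a ∈ I.adom, ∀ b ∈ I.adom, Sim I inv feat (i + 1) a b ↔ Sim I inv feat i a b := by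
        intro a ha b hb
        have : (a, b) ∈ A (i + 1) ↔ (a, b) ∈ A i := by rw [e]
        rw [hmem, hmem] at this
        simpa [ha, hb] using this
      ext ⟨a, b⟩
      rw [hmem, hmem]
      refine and_congr_right fun hab => ?_
      refine (sim_succ_iff (i := i + 1) subset_rfl).trans
        (Iff.trans ?_ (sim_succ_iff (i := i) subset_rfl).symm)
      rw [e' a hab.1 b hab.2]
      refine and_congr_right fun _ => forall_congr' fun R => forall_congr' fun hR =>
        forall_congr' fun c => forall_congr' fun hc => ?_
      have e2 : ∀ d, I.succ R d ∩ {z | Sim I inv feat (i + 1) z c} =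
          I.succ R d ∩ {z | Sim I inv feat i z c} := by
        intro d
        ext z
        refine and_congr_right fun hz => e' z (I.succ_subset_adom R d hz) c hc
      rw [e2, e2]) hcard
  refine h.indist (fun a ha b hb hab => ?_) ha hb
  have : (a, b) ∈ A (m + 1) := by
    rw [hst, hmem]
    exact ⟨⟨ha, hb⟩, hab⟩
  exact ((hmem _ _ _).1 this).2

end Equivalence

/-! ### Reading the input word -/

section Words

/-- The bits at the start of a word. -/
def leadingBits : List Sym → List Bool
  | .bit b :: t => b :: leadingBits t
  | _ => []

/-- The binary word that follows the position `p`. It is defined at every position, not only at the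
positions where the encoding of a name starts. -/
def wordAt (w : List Sym) (p : ℕ) : List Bool := leadingBits (w.drop (p + 1))

/-- The position `q` holds the first end symbol after the position `p`. -/
def NextSep (w : List Sym) (p q : ℕ) : Prop :=
  p < q ∧ w[q]? = some .sep ∧ ∀ z, p < z → z < q → w[z]? ≠ some .sep

lemma NextSep.lt_length {w : List Sym} {p q : ℕ} (h : NextSep w p q) : q < w.length := by
  by_contra hq
  have := h.2.1
  rw [List.getElem?_eq_none (by omega)] at this
  simp at this

lemma NextSep.unique {w : List Sym} {p q q' : ℕ} (h : NextSep w p q) (h' : NextSep w p q') :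
    q = q' := by
  rcases lt_trichotomy q q' with hlt | heq | hlt
  · exact absurd h.2.1 (h'.2.2 q h.1 hlt)
  · exact heq
  · exact absurd h'.2.1 (h.2.2 q' h'.1 hlt)

lemma leadingBits_encodeWord (u : List Bool) (t : List Sym) :
    leadingBits (encodeWord u ++ t) = u := by
  induction u with
  | nil => rfl
  | cons b u ih => exact congrArg (b :: ·) ih

lemma wordAt_of_drop {w : List Sym} {p : ℕ} {u : List Bool} {t : List Sym}
    (h : w.drop (p + 1) = encodeWord u ++ t) : wordAt w p = u := by
  rw [wordAt, h, leadingBits_encodeWord]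

lemma nextSep_of_drop {w : List Sym} {p : ℕ} {u : List Bool} {t : List Sym}
    (h : w.drop (p + 1) = encodeWord u ++ t) : NextSep w p (p + 1 + u.length) := by
  have hget : ∀ i, w[p + 1 + i]? = (encodeWord u ++ t)[i]? := by
    intro i; rw [← h, List.getElem?_drop]
  refine ⟨by omega, ?_, fun z hz hz' => ?_⟩
  · rw [hget]
    simp [encodeWord]
  · obtain ⟨i, rfl⟩ : ∃ i, z = p + 1 + i := ⟨z - (p + 1), by omega⟩
    have hi : i < u.length := by omega
    rw [hget]
    simp [encodeWord, List.getElem?_append_left, hi]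

lemma drop_of_drop {w : List Sym} {p : ℕ} {u : List Bool} {t : List Sym}
    (h : w.drop (p + 1) = encodeWord u ++ t) : w.drop (p + 1 + u.length + 1) = t := by
  have : p + 1 + u.length + 1 = (p + 1) + (encodeWord u).length := by
    simp [encodeWord]; omega
  rw [this, ← List.drop_drop, h, List.drop_left]

lemma drop_succ_of_drop {w : List Sym} {p : ℕ} {s : Sym} {t : List Sym} (h : w.drop p = s :: t) :
    w[p]? = some s ∧ w.drop (p + 1) = t := by
  constructor
  · have := congrArg (·[0]?) h
    simpa using this
  · rw [← List.drop_drop, h]; rfl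

/-- At the position `p` there is the symbol `s`, followed by at least two words, of which the
first two are `u` and `v`. -/
def PairAt (w : List Sym) (s : Sym) (p : ℕ) (u v : List Bool) : Prop :=
  w[p]? = some s ∧ wordAt w p = u ∧ ∃ q, NextSep w p q ∧ wordAt w q = v

/-- At the position `p` there is the symbol `s`, followed by at least three words, of which the
first three are `u`, `v` and `z`. -/
def TripleAt (w : List Sym) (s : Sym) (p : ℕ) (u v z : List Bool) : Prop :=
  w[p]? = some s ∧ wordAt w p = u ∧
    ∃ q, NextSep w p q ∧ wordAt w q = v ∧ ∃ q', NextSep w q q' ∧ wordAt w q' = z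

lemma pairAt_iff_of_drop {w : List Sym} {p : ℕ} {s s' : Sym} {u v u' v' : List Bool} {t : List Sym}
    (h : w.drop p = s :: (encodeWord u ++ encodeWord v) ++ t) :
    PairAt w s' p u' v' ↔ s = s' ∧ u = u' ∧ v = v' := by
  rw [List.cons_append, List.append_assoc] at h
  obtain ⟨h0, h1⟩ := drop_succ_of_drop h
  have h2 := drop_of_drop h1
  have hn := nextSep_of_drop h1
  rw [PairAt, h0, wordAt_of_drop h1]
  constructor
  · rintro ⟨e, rfl, q, hq, rfl⟩
    obtain rfl := hn.unique hq
    exact ⟨Option.some_injective _ e, rfl, (wordAt_of_drop h2).symm⟩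
  · rintro ⟨rfl, rfl, rfl⟩
    exact ⟨rfl, rfl, _, hn, wordAt_of_drop h2⟩

lemma tripleAt_iff_of_drop {w : List Sym} {p : ℕ} {s s' : Sym} {u v z u' v' z' : List Bool}
    {t : List Sym} (h : w.drop p = s :: (encodeWord u ++ encodeWord v ++ encodeWord z) ++ t) :
    TripleAt w s' p u' v' z' ↔ s = s' ∧ u = u' ∧ v = v' ∧ z = z' := by
  rw [List.cons_append, List.append_assoc, List.append_assoc] at h
  obtain ⟨h0, h1⟩ := drop_succ_of_drop h
  have h2 := drop_of_drop h1
  have h3 := drop_of_drop h2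
  have hn := nextSep_of_drop h1
  have hn' := nextSep_of_drop h2
  rw [TripleAt, h0, wordAt_of_drop h1]
  constructor
  · rintro ⟨e, rfl, q, hq, rfl, q', hq', rfl⟩
    obtain rfl := hn.unique hq
    obtain rfl := hn'.unique hq'
    exact ⟨Option.some_injective _ e, rfl, (wordAt_of_drop h2).symm, (wordAt_of_drop h3).symm⟩
  · rintro ⟨rfl, rfl, rfl, rfl⟩
    exact ⟨rfl, rfl, _, hn, wordAt_of_drop h2, _, hn', wordAt_of_drop h3⟩

/-- The symbol announces a fact or an example. -/
def Sym.IsMarker : Sym → Prop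
  | .bit _ => False
  | .sep => False
  | _ => True

lemma not_isMarker_of_mem_encodeWord {u : List Bool} {s : Sym} (h : s ∈ encodeWord u) :
    ¬ s.IsMarker := by
  simp only [encodeWord, List.mem_append, List.mem_map, List.mem_singleton] at h
  rcases h with ⟨b, _, rfl⟩ | rfl <;> exact id

/-- A block is a marker followed by symbols that are not markers. -/
def IsBlock (l : List Sym) : Prop := ∃ s t, l = s :: t ∧ ∀ a ∈ t, ¬ a.IsMarker

/-- In a concatenation of blocks, a block starts at every marker. -/
lemma exists_block_of_isMarker {L : List (List Sym)} (hL : ∀ l ∈ L, IsBlock l) {p : ℕ} {s : Sym}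
    (hp : L.flatten[p]? = some s) (hs : s.IsMarker) :
    ∃ l ∈ L, ∃ t, L.flatten.drop p = l ++ t := by
  induction L generalizing p with
  | nil => simp at hp
  | cons l L ih =>
    rw [List.flatten_cons] at hp ⊢
    by_cases hpl : p < l.length
    · obtain ⟨s', t, rfl, ht⟩ := hL l (by simp)
      cases p with
      | zero => exact ⟨_, List.mem_cons_self, L.flatten, rfl⟩
      | succ p =>
        rw [List.getElem?_append_left hpl, List.getElem?_cons_succ] at hp
        exact absurd hs (ht s (List.mem_of_getElem? hp))
    · rw [List.getElem?_append_right (by omega)] at hp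
      obtain ⟨l', hl', t, e⟩ := ih (fun l hl => hL l (List.mem_cons_of_mem _ hl)) hp
      refine ⟨l', List.mem_cons_of_mem _ hl', t, ?_⟩
      rw [← e, List.drop_append, List.drop_eq_nil_of_le (by omega), List.nil_append]

lemma exists_drop_flatten {L : List (List Sym)} {l : List Sym} (hl : l ∈ L) :
    ∃ p t, L.flatten.drop p = l ++ t := by
  obtain ⟨L₁, L₂, rfl⟩ := List.append_of_mem hl
  refine ⟨L₁.flatten.length, L₂.flatten, ?_⟩
  rw [List.flatten_append, List.drop_left, List.flatten_cons]

end Words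

namespace FittingInput

variable {𝔻 : FeatureDomains} (x : FittingInput 𝔻)

/-- The blocks of the input word. -/
def blocks : List (List Sym) :=
  x.factList.map DBFact.encode ++ x.posList.map (fun a => Sym.pos :: encodeWord a) ++
    x.negList.map (fun a => Sym.neg :: encodeWord a)

lemma encode_eq_flatten_blocks : x.encode = x.blocks.flatten := by
  simp [encode, blocks, List.flatMap_def]

lemma mem_blocks {l : List Sym} : l ∈ x.blocks ↔ (∃ φ ∈ x.I.facts, l = φ.encode) ∨
    (∃ a ∈ x.P, l = Sym.pos :: encodeWord a) ∨ ∃ a ∈ x.N, l = Sym.neg :: encodeWord a := by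
  simp only [blocks, List.mem_append, List.mem_map, x.mem_factList, x.mem_posList, x.mem_negList,
    or_assoc, eq_comm]

lemma isBlock_of_mem_blocks {l : List Sym} (hl : l ∈ x.blocks) : IsBlock l := by
  rcases x.mem_blocks.1 hl with ⟨φ, _, rfl⟩ | ⟨a, _, rfl⟩ | ⟨a, _, rfl⟩
  · cases φ with
    | concept A a =>
      refine ⟨_, _, rfl, fun s hs => ?_⟩
      rcases List.mem_append.1 hs with hs | hs <;> exact not_isMarker_of_mem_encodeWord hs
    | role r a b =>
      refine ⟨_, _, rfl, fun s hs => ?_⟩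
      rcases List.mem_append.1 hs with hs | hs
      · rcases List.mem_append.1 hs with hs | hs <;> exact not_isMarker_of_mem_encodeWord hs
      · exact not_isMarker_of_mem_encodeWord hs
    | feature f a v =>
      refine ⟨_, _, rfl, fun s hs => ?_⟩
      rcases List.mem_append.1 hs with hs | hs
      · rcases List.mem_append.1 hs with hs | hs <;> exact not_isMarker_of_mem_encodeWord hs
      · exact not_isMarker_of_mem_encodeWord hs
  · exact ⟨_, _, rfl, fun s hs => not_isMarker_of_mem_encodeWord hs⟩
  · exact ⟨_, _, rfl, fun s hs => not_isMarker_of_mem_encodeWord hs⟩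

lemma exists_block {p : ℕ} {s : Sym} (hp : x.encode[p]? = some s) (hs : s.IsMarker) :
    ∃ l ∈ x.blocks, ∃ t, x.encode.drop p = l ++ t := by
  rw [encode_eq_flatten_blocks] at hp ⊢
  exact exists_block_of_isMarker (fun _ => x.isBlock_of_mem_blocks) hp hs

lemma exists_drop {l : List Sym} (hl : l ∈ x.blocks) : ∃ p t, x.encode.drop p = l ++ t := by
  rw [encode_eq_flatten_blocks]
  exact exists_drop_flatten hl

lemma exists_fact_of_getElem? {p : ℕ} {s : Sym} (hp : x.encode[p]? = some s)
    (hs : s = .concept ∨ s = .role ∨ s = .feature) :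
    ∃ φ ∈ x.I.facts, ∃ t, x.encode.drop p = φ.encode ++ t := by
  obtain ⟨l, hl, t, e⟩ := x.exists_block hp (by rcases hs with rfl | rfl | rfl <;> trivial)
  rcases x.mem_blocks.1 hl with ⟨φ, h, rfl⟩ | ⟨a, _, rfl⟩ | ⟨a, _, rfl⟩
  · exact ⟨φ, h, t, e⟩
  all_goals
    have := (drop_succ_of_drop e).1
    rw [hp] at this
    rcases hs with rfl | rfl | rfl <;> simp at this

lemma exists_drop_of_mem_facts {φ : DBFact 𝔻} (h : φ ∈ x.I.facts) :
    ∃ p t, x.encode.drop p = φ.encode ++ t :=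
  x.exists_drop (x.mem_blocks.2 (Or.inl ⟨φ, h, rfl⟩))

/-- The facts can be read off the input word, because every marker starts the encoding of a fact or
of an example. -/
theorem exists_concept_iff {A : ConceptName} {a : IndName} :
    (∃ p, PairAt x.encode .concept p A a) ↔ DBFact.concept A a ∈ x.I.facts := by
  constructor
  · rintro ⟨p, hp⟩
    obtain ⟨φ, hφ, t, e⟩ := x.exists_fact_of_getElem? hp.1 (by simp)
    cases φ with
    | concept A' a' =>
      obtain ⟨_, rfl, rfl⟩ := (pairAt_iff_of_drop e).1 hp
      exact hφ
    | role r a b => have := (drop_succ_of_drop e).1; rw [hp.1] at this; simp at this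
    | feature f a v => have := (drop_succ_of_drop e).1; rw [hp.1] at this; simp at this
  · intro h
    obtain ⟨p, t, e⟩ := x.exists_drop_of_mem_facts h
    exact ⟨p, (pairAt_iff_of_drop e).2 ⟨rfl, rfl, rfl⟩⟩

theorem exists_role_iff {r : RoleName} {a b : IndName} :
    (∃ p, TripleAt x.encode .role p r a b) ↔ DBFact.role r a b ∈ x.I.facts := by
  constructor
  · rintro ⟨p, hp⟩
    obtain ⟨φ, hφ, t, e⟩ := x.exists_fact_of_getElem? hp.1 (by simp)
    cases φ with
    | concept A a => have := (drop_succ_of_drop e).1; rw [hp.1] at this; simp at this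
    | role r' a' b' =>
      obtain ⟨_, rfl, rfl, rfl⟩ := (tripleAt_iff_of_drop e).1 hp
      exact hφ
    | feature f a v => have := (drop_succ_of_drop e).1; rw [hp.1] at this; simp at this
  · intro h
    obtain ⟨p, t, e⟩ := x.exists_drop_of_mem_facts h
    exact ⟨p, (tripleAt_iff_of_drop e).2 ⟨rfl, rfl, rfl, rfl⟩⟩

/-- The values of the features are known through their codes only. -/
theorem exists_feature_iff {f : FeatureName} {a : IndName} {u : List Bool} :
    (∃ p, TripleAt x.encode .feature p f a u) ↔
      ∃ v, DBFact.feature f a v ∈ x.I.facts ∧ 𝔻.code f v = u := by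
  constructor
  · rintro ⟨p, hp⟩
    obtain ⟨φ, hφ, t, e⟩ := x.exists_fact_of_getElem? hp.1 (by simp)
    cases φ with
    | concept A a => have := (drop_succ_of_drop e).1; rw [hp.1] at this; simp at this
    | role r a b => have := (drop_succ_of_drop e).1; rw [hp.1] at this; simp at this
    | feature f' a' v =>
      obtain ⟨_, rfl, rfl, rfl⟩ := (tripleAt_iff_of_drop e).1 hp
      exact ⟨v, hφ, rfl⟩
  · rintro ⟨v, h, rfl⟩
    obtain ⟨p, t, e⟩ := x.exists_drop_of_mem_facts h
    exact ⟨p, (tripleAt_iff_of_drop e).2 ⟨rfl, rfl, rfl, rfl⟩⟩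

theorem exists_example_iff {a : IndName} :
    ((∃ p, x.encode[p]? = some .pos ∧ wordAt x.encode p = a) ↔ a ∈ x.P) ∧
    ((∃ p, x.encode[p]? = some .neg ∧ wordAt x.encode p = a) ↔ a ∈ x.N) := by
  have key : ∀ s, s = Sym.pos ∨ s = Sym.neg → ∀ p, x.encode[p]? = some s →
      (s = Sym.pos ∧ wordAt x.encode p ∈ x.P) ∨ (s = Sym.neg ∧ wordAt x.encode p ∈ x.N) := by
    intro s hs p hp
    obtain ⟨l, hl, t, e⟩ := x.exists_block hp (by rcases hs with rfl | rfl <;> trivial)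
    rcases x.mem_blocks.1 hl with ⟨φ, _, rfl⟩ | ⟨b, hb, rfl⟩ | ⟨b, hb, rfl⟩
    · cases φ <;>
      · have := (drop_succ_of_drop e).1
        rw [hp] at this
        rcases hs with rfl | rfl <;> simp at this
    · obtain ⟨h0, h1⟩ := drop_succ_of_drop e
      rw [hp] at h0
      rw [wordAt_of_drop h1]
      exact Or.inl ⟨Option.some_injective _ h0, hb⟩
    · obtain ⟨h0, h1⟩ := drop_succ_of_drop e
      rw [hp] at h0
      rw [wordAt_of_drop h1]
      exact Or.inr ⟨Option.some_injective _ h0, hb⟩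
  refine ⟨⟨?_, fun h => ?_⟩, ⟨?_, fun h => ?_⟩⟩
  · rintro ⟨p, hp, rfl⟩
    simpa using key _ (Or.inl rfl) p hp
  · obtain ⟨p, t, e⟩ := x.exists_drop (x.mem_blocks.2 (Or.inr (Or.inl ⟨a, h, rfl⟩)))
    obtain ⟨h0, h1⟩ := drop_succ_of_drop e
    exact ⟨p, h0, wordAt_of_drop h1⟩
  · rintro ⟨p, hp, rfl⟩
    simpa using key _ (Or.inr rfl) p hp
  · obtain ⟨p, t, e⟩ := x.exists_drop (x.mem_blocks.2 (Or.inr (Or.inr ⟨a, h, rfl⟩)))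
    obtain ⟨h0, h1⟩ := drop_succ_of_drop e
    exact ⟨p, h0, wordAt_of_drop h1⟩

/-- Every individual of the database occurs in the input word. -/
theorem exists_wordAt_eq {a : IndName} (ha : a ∈ x.I.adom) :
    ∃ p : Fin x.encode.length, wordAt x.encode p = a := by
  obtain ⟨φ, hφ, ha⟩ := ha
  cases φ with
  | concept A b =>
    obtain ⟨p, _, _, q, hq, e⟩ := x.exists_concept_iff.2 hφ
    obtain rfl : a = b := ha
    exact ⟨⟨q, hq.lt_length⟩, e⟩
  | role r b c =>
    obtain ⟨p, _, _, q, hq, e, q', hq', e'⟩ := x.exists_role_iff.2 hφ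
    rcases ha with rfl | ha
    · exact ⟨⟨q, hq.lt_length⟩, e⟩
    · obtain rfl : a = c := ha
      exact ⟨⟨q', hq'.lt_length⟩, e'⟩
  | feature f b v =>
    obtain ⟨p, _, _, q, hq, e, _⟩ := x.exists_feature_iff.2 ⟨v, hφ, rfl⟩
    obtain rfl : a = b := ha
    exact ⟨⟨q, hq.lt_length⟩, e⟩

end FittingInput

/-! ### Derived formulas -/

namespace Fm

variable {V J : Type}

/-- Disjunction. -/
def or (φ ψ : Fm V J) : Fm V J := .not (.and (.not φ) (.not ψ))

/-- Implication. -/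
def imp (φ ψ : Fm V J) : Fm V J := .not (.and φ (.not ψ))

/-- Equivalence. -/
def iff (φ ψ : Fm V J) : Fm V J := .and (imp φ ψ) (imp ψ φ)

/-- Existential quantification: it is false that at most as many positions satisfy `φ` as satisfy
a contradiction. -/
def ex (x : V) (φ : Fm V J) : Fm V J := .not (.cle x φ (.not (.le x x)))

/-- Universal quantification. -/
def all (x : V) (φ : Fm V J) : Fm V J := .not (ex x (.not φ))

/-- Equally many positions `x` satisfy `φ` and `ψ`. -/
def ceq (x : V) (φ ψ : Fm V J) : Fm V J := .and (.cle x φ ψ) (.cle x ψ φ)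

end Fm

section Holds

variable {V J : Type} [DecidableEq V] {w : List Sym} {ρ : J → List Sym} {e : V → ℕ}
  {φ ψ : Fm V J} {x y : V}

@[simp] lemma holds_sym {s : Sym} : Holds w ρ e (.sym x s) ↔ w[e x]? = some s := by
  simp only [Holds]

@[simp] lemma holds_rel {j : J} :
    Holds w ρ e (.rel j x y) ↔ (ρ j)[w.length * e x + e y]? = some (.bit true) := by
  simp only [Holds]

@[simp] lemma holds_le : Holds w ρ e (.le x y) ↔ e x ≤ e y := by simp only [Holds]

@[simp] lemma holds_not : Holds w ρ e (.not φ) ↔ ¬ Holds w ρ e φ := by simp only [Holds]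

@[simp] lemma holds_and : Holds w ρ e (.and φ ψ) ↔ Holds w ρ e φ ∧ Holds w ρ e ψ := by
  simp only [Holds]

@[simp] lemma holds_or : Holds w ρ e (.or φ ψ) ↔ Holds w ρ e φ ∨ Holds w ρ e ψ := by
  simp only [Fm.or, holds_not, holds_and]; tauto

@[simp] lemma holds_imp : Holds w ρ e (.imp φ ψ) ↔ (Holds w ρ e φ → Holds w ρ e ψ) := by
  simp only [Fm.imp, holds_not, holds_and]; tauto

@[simp] lemma holds_iff : Holds w ρ e (.iff φ ψ) ↔ (Holds w ρ e φ ↔ Holds w ρ e ψ) := by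
  simp only [Fm.iff, holds_imp, holds_and]; tauto

lemma count_eq_ncard (n : ℕ) (p : ℕ → Prop) [DecidablePred p] :
    Nat.count p n = {i : Fin n | p i}.ncard := by
  rw [Nat.count_eq_card_filter_range, ← Set.ncard_coe_finset,
    ← Set.ncard_image_of_injective _ Fin.val_injective]
  congr 1
  ext i
  simp only [Finset.coe_filter, Finset.mem_range, Set.mem_ofPred_eq, Set.mem_image]
  exact ⟨fun h => ⟨⟨i, h.1⟩, h.2, rfl⟩, by rintro ⟨i, h, rfl⟩; exact ⟨i.2, h⟩⟩

lemma holds_cle : Holds w ρ e (.cle x φ ψ) ↔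
    {i : Fin w.length | Holds w ρ (Function.update e x i) φ}.ncard ≤
      {i : Fin w.length | Holds w ρ (Function.update e x i) ψ}.ncard := by
  simp only [Holds]
  rw [count_eq_ncard, count_eq_ncard]

@[simp] lemma holds_ceq : Holds w ρ e (.ceq x φ ψ) ↔
    {i : Fin w.length | Holds w ρ (Function.update e x i) φ}.ncard =
      {i : Fin w.length | Holds w ρ (Function.update e x i) ψ}.ncard := by
  simp only [Fm.ceq, holds_and, holds_cle]
  exact le_antisymm_iff.symm

@[simp] lemma holds_ex : Holds w ρ e (.ex x φ) ↔
    ∃ i : Fin w.length, Holds w ρ (Function.update e x i) φ := by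
  simp only [Fm.ex, holds_not, holds_cle, holds_le, le_refl, not_true_eq_false]
  rw [show {i : Fin w.length | False} = ∅ from rfl, Set.ncard_empty, not_le, Set.ncard_pos]
  exact Iff.rfl

@[simp] lemma holds_all : Holds w ρ e (.all x φ) ↔
    ∀ i : Fin w.length, Holds w ρ (Function.update e x i) φ := by
  simp [Fm.all]

/-- The relation symbol `j` is interpreted by the relation `R` on the positions. -/
def Reads (w : List Sym) (ρ : J → List Sym) (j : J) (R : ℕ → ℕ → Prop) : Prop :=
  ∀ a b : Fin w.length, (ρ j)[w.length * a + b]? = some (.bit true) ↔ R a b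

lemma Reads.holds {j : J} {R : ℕ → ℕ → Prop} (h : Reads w ρ j R) (hx : e x < w.length)
    (hy : e y < w.length) : Holds w ρ e (.rel j x y) ↔ R (e x) (e y) := by
  rw [holds_rel]
  exact h ⟨e x, hx⟩ ⟨e y, hy⟩

variable [DecidableEq J]

lemma reads_assign_self {j : J} {R : ℕ → ℕ → Prop}
    (h : ∀ a b : Fin w.length,
      Holds w ρ (Function.update (Function.update e x a) y b) φ ↔ R a b) :
    Reads w ((Cmd.assign j x y φ).exec w e ρ) j R := by
  intro a b
  rw [Cmd.exec, Function.update_self, getElem?_table _ a.2 b.2]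
  simp [h]

lemma reads_assign_of_ne {j j' : J} {R : ℕ → ℕ → Prop} (hj : j' ≠ j) (h : Reads w ρ j' R) :
    Reads w ((Cmd.assign j x y φ).exec w e ρ) j' R := by
  intro a b
  rw [Cmd.exec, Function.update_of_ne hj]
  exact h a b

/-- The induction principle for loops: `P i` is an invariant that holds before round `i`. -/
lemma exec_rep {c : Cmd V J} (P : ℕ → (J → List Sym) → Prop) (h0 : P 0 ρ)
    (h : ∀ i e ρ, P i ρ → P (i + 1) (c.exec w e ρ)) :
    P w.length ((Cmd.rep x c).exec w e ρ) := by
  have : ∀ m, P m (Nat.rec ρ (fun i ρ => c.exec w (Function.update e x i) ρ) m) := by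
    intro m
    induction m with
    | zero => exact h0
    | succ m ih => exact h _ _ _ ih
  exact this _

end Holds

/-! ### The decision procedure -/

/-- The variables of the decision procedure. -/
inductive Var where
  | x | x₁ | y | y₁ | z | u | c | p | p₁ | p₂ | q | q₁ | q₂ | i | k
  deriving DecidableEq

instance : Fintype Var :=
  ⟨{.x, .x₁, .y, .y₁, .z, .u, .c, .p, .p₁, .p₂, .q, .q₁, .q₂, .i, .k}, by intro v; cases v <;> simp⟩

/-- The relations that the decision procedure computes. -/
inductive Rel where
  /-- the successor relation on the positions -/
  | suc
  /-- the relation `NextSep` -/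
  | nextSep
  /-- the same word follows both positions -/
  | same
  /-- the approximations `Sim` -/
  | sim
  deriving DecidableEq

instance : Fintype Rel := ⟨{.suc, .nextSep, .same, .sim}, by intro j; cases j <;> simp⟩

namespace Procedure

open Fm

/-- The definition of the successor relation. -/
def sucFm : Fm Var Rel := .and (.not (.le .y .x)) (.all .z (.imp (.not (.le .z .x)) (.le .y .z)))

/-- The definition of `NextSep`. -/
def nextSepFm : Fm Var Rel :=
  .and (.not (.le .y .x)) (.and (.sym .y .sep)
    (.all .z (.imp (.not (.le .z .x)) (.imp (.not (.le .y .z)) (.not (.sym .z .sep))))))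

/-- The position after `v` holds a bit. -/
def bitFm (v : Var) : Fm Var Rel :=
  .ex .z (.and (.rel .suc v .z) (.or (.sym .z (.bit false)) (.sym .z (.bit true))))

/-- One step of the computation of the relation `same`: both words are empty, or they start with the
same bit and continue with the same word. -/
def sameFm : Fm Var Rel :=
  .or (.and (.not (bitFm .x)) (.not (bitFm .y)))
    (.ex .x₁ (.ex .y₁ (.and (.rel .suc .x .x₁) (.and (.rel .suc .y .y₁) (.and (.rel .same .x₁ .y₁)
      (.or (.and (.sym .x₁ (.bit false)) (.sym .y₁ (.bit false)))
        (.and (.sym .x₁ (.bit true)) (.sym .y₁ (.bit true)))))))))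

/-- The database says that the concept name at `p` holds of the individual at `v`. -/
def pairFm (v : Var) : Fm Var Rel :=
  .ex .q (.ex .q₁ (.and (.sym .q .concept) (.and (.rel .same .q .p)
    (.and (.rel .nextSep .q .q₁) (.rel .same .q₁ v)))))

/-- The database has a fact of the kind `s` for the name at `p` with the arguments at `v` and
`v'`. -/
def tripleFm (s : Sym) (v v' : Var) : Fm Var Rel :=
  .ex .q (.ex .q₁ (.ex .q₂ (.and (.sym .q s) (.and (.rel .same .q .p)
    (.and (.rel .nextSep .q .q₁) (.and (.rel .same .q₁ v)
      (.and (.rel .nextSep .q₁ .q₂) (.rel .same .q₂ v'))))))))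

/-- The individuals at `x` and `y` have the same concept names. -/
def conceptsFm : Fm Var Rel := .all .p (.imp (.sym .p .concept) (.iff (pairFm .x) (pairFm .y)))

/-- The individuals at `x` and `y` have the same feature values. The values are compared through the
codes that occur in the input. -/
def featuresFm : Fm Var Rel :=
  .all .p (.all .p₁ (.all .p₂ (.imp (.and (.sym .p .feature)
    (.and (.rel .nextSep .p .p₁) (.rel .nextSep .p₁ .p₂)))
      (.iff (tripleFm .feature .x .p₂) (tripleFm .feature .y .p₂)))))

/-- The definition of `Sim` at stage `0`. -/
def simZeroFm (feat : Bool) : Fm Var Rel :=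
  if feat then .and conceptsFm featuresFm else conceptsFm

/-- The position `z` is the first position that is followed by the same word. -/
def firstFm : Fm Var Rel := .all .u (.imp (.rel .same .u .z) (.le .z .u))

/-- For every role name, the individuals at `x` and `y` have equally many successors in every
class. Only the first occurrence of a successor is counted. -/
def succFm : Fm Var Rel :=
  .all .p (.all .c (.imp (.sym .p .role) (.ceq .z
    (.and firstFm (.and (tripleFm .role .x .z) (.rel .sim .z .c)))
    (.and firstFm (.and (tripleFm .role .y .z) (.rel .sim .z .c))))))

/-- For every role name, the individuals at `x` and `y` have equally many predecessors in every
class. -/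
def predFm : Fm Var Rel :=
  .all .p (.all .c (.imp (.sym .p .role) (.ceq .z
    (.and firstFm (.and (tripleFm .role .z .x) (.rel .sim .z .c)))
    (.and firstFm (.and (tripleFm .role .z .y) (.rel .sim .z .c))))))

/-- The step from a stage of `Sim` to the next one. -/
def simSuccFm (inv : Bool) : Fm Var Rel :=
  .and (.rel .sim .x .y) (if inv then .and succFm predFm else succFm)

/-- The computation of the relations. The number of stages of `Sim` is the square of the length
of the input word. -/
def cmd (inv feat : Bool) : Cmd Var Rel :=
  .seq (.assign .suc .x .y sucFm) (.seq (.assign .nextSep .x .y nextSepFm)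
    (.seq (.rep .i (.assign .same .x .y sameFm)) (.seq (.assign .sim .x .y (simZeroFm feat))
      (.rep .i (.rep .k (.assign .sim .x .y (simSuccFm inv)))))))

/-- No positive example is related to a negative example. -/
def answerFm : Fm Var Rel :=
  .all .p (.all .q (.imp (.and (.sym .p .pos) (.sym .q .neg)) (.not (.rel .sim .p .q))))

lemma proper_cmd (inv feat : Bool) : (cmd inv feat).Proper := by
  cases inv <;> cases feat <;>
  simp [cmd, Cmd.Proper, Cmd.bound, sucFm, nextSepFm, sameFm, bitFm, simZeroFm, conceptsFm,
    featuresFm, pairFm, tripleFm, simSuccFm, succFm, predFm, firstFm, Fm.Proper, Fm.bound, Fm.or,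
    Fm.imp, Fm.iff, Fm.ex, Fm.all, Fm.ceq]

lemma proper_answerFm : answerFm.Proper := by
  simp [answerFm, Fm.Proper, Fm.bound, Fm.imp, Fm.ex, Fm.all]

section Words

variable {w : List Sym} {ρ : Rel → List Sym} {e : Var → ℕ}

lemma reads_suc : Reads w ((Cmd.assign .suc .x .y sucFm).exec w e ρ) .suc fun a b => b = a + 1 := by
  refine reads_assign_self fun a b => ?_
  simp [sucFm]
  constructor
  · rintro ⟨h1, h2⟩
    by_contra hne
    have h3 : (a : ℕ) + 1 < w.length := by have := b.2; omega
    have := h2 ⟨a + 1, h3⟩ (Fin.lt_def.2 (by simp))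
    have := Fin.le_def.1 this
    have := Fin.lt_def.1 h1
    simp at *
    omega
  · intro h
    refine ⟨Fin.lt_def.2 (by omega), fun i hi => Fin.le_def.2 ?_⟩
    have := Fin.lt_def.1 hi
    omega

lemma reads_nextSep : Reads w ((Cmd.assign .nextSep .x .y nextSepFm).exec w e ρ) .nextSep
    (NextSep w) := by
  refine reads_assign_self fun a b => ?_
  simp only [nextSepFm, NextSep, holds_and, holds_not, holds_le, holds_sym, holds_all, holds_imp,
    Function.update_apply, reduceCtorEq, if_false, if_true, not_le]
  refine and_congr_right fun _ => and_congr_right fun _ => ?_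
  exact ⟨fun h z hz hz' => h ⟨z, hz'.trans b.2⟩ hz hz', fun h z hz hz' => h z hz hz'⟩

/-- The recursion that the computation of `same` follows. -/
lemma wordAt_cases (w : List Sym) (p : ℕ) :
    (∃ b, w[p + 1]? = some (.bit b) ∧ wordAt w p = b :: wordAt w (p + 1)) ∨
      (∀ b, w[p + 1]? ≠ some (.bit b)) ∧ wordAt w p = [] := by
  by_cases h : p + 1 < w.length
  · rw [wordAt, List.drop_eq_getElem_cons h, List.getElem?_eq_getElem h, wordAt]
    cases w[p + 1] <;> simp [leadingBits]
  · rw [wordAt, List.drop_eq_nil_of_le (by omega), List.getElem?_eq_none (by omega)]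
    simp [leadingBits]

lemma length_leadingBits_le (l : List Sym) : (leadingBits l).length ≤ l.length := by
  induction l with
  | nil => rfl
  | cons s l ih => cases s <;> simp [leadingBits, ih]

lemma length_wordAt_lt {p : ℕ} (hp : p < w.length) : (wordAt w p).length < w.length := by
  have := length_leadingBits_le (w.drop (p + 1))
  rw [List.length_drop] at this
  rw [wordAt]
  omega

/-- After `m` steps, `same` is correct for the words that are shorter than `m`. -/
lemma reads_same_step {m : ℕ} (h0 : Reads w ρ .suc fun a b => b = a + 1)
    (h : Reads w ρ .same fun a b => wordAt w a = wordAt w b ∧ (wordAt w a).length < m) :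
    Reads w ((Cmd.assign .same .x .y sameFm).exec w e ρ) .same
      fun a b => wordAt w a = wordAt w b ∧ (wordAt w a).length < m + 1 := by
  refine reads_assign_self fun a b => ?_
  have hbit : ∀ (e : Var → ℕ) (v : Var), v ≠ .z → e v < w.length →
      (Holds w ρ e (bitFm v) ↔ ∃ b, w[e v + 1]? = some (.bit b)) := by
    intro e v hv hlt
    simp only [bitFm, holds_ex, holds_and, holds_or, holds_sym]
    constructor
    · rintro ⟨i, h1, h2⟩
      rw [h0.holds (by simpa [hv] using hlt) (by simp)] at h1
      simp only [Function.update_self, Function.update_of_ne hv] at h1 h2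
      rw [← h1]
      exact h2.elim (fun h => ⟨_, h⟩) fun h => ⟨_, h⟩
    · rintro ⟨b, hb⟩
      have hl : e v + 1 < w.length := (List.getElem?_eq_some_iff.1 hb).1
      refine ⟨⟨_, hl⟩, (h0.holds (by simpa [hv] using hlt) (by simp [hl])).2 (by simp [hv]), ?_⟩
      simp only [Function.update_self, hb]
      cases b <;> simp
  have hstep : ∀ (e : Var → ℕ), e .x = a → e .y = b → (Holds w ρ e sameFm ↔
      (¬ ∃ b, w[(a : ℕ) + 1]? = some (.bit b)) ∧ (¬ ∃ c, w[(b : ℕ) + 1]? = some (.bit c)) ∨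
        ∃ c, w[(a : ℕ) + 1]? = some (.bit c) ∧ w[(b : ℕ) + 1]? = some (.bit c) ∧
          wordAt w (a + 1) = wordAt w (b + 1) ∧ (wordAt w (a + 1)).length < m) := by
    intro e ha hb
    have ha' : e .x < w.length := by omega
    have hb' : e .y < w.length := by omega
    simp only [sameFm, holds_or, holds_and, holds_not, holds_ex, holds_sym]
    rw [hbit e .x (by simp) ha', hbit e .y (by simp) hb', ha, hb]
    refine or_congr_right ⟨?_, ?_⟩
    · rintro ⟨i, k, h1, h2, h3, h4⟩
      rw [h0.holds (by simpa using ha') (by simp)] at h1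
      rw [h0.holds (by simpa using hb') (by simp)] at h2
      rw [h.holds (by simp) (by simp)] at h3
      simp only [Function.update_apply, reduceCtorEq, if_false, if_true, ha, hb] at h1 h2 h3 h4
      rw [h1, h2] at h3 h4
      exact h4.elim (fun h4 => ⟨_, h4.1, h4.2, h3⟩) fun h4 => ⟨_, h4.1, h4.2, h3⟩
    · rintro ⟨c, h1, h2, h3⟩
      have hl := (List.getElem?_eq_some_iff.1 h1).1
      have hl' := (List.getElem?_eq_some_iff.1 h2).1
      refine ⟨⟨_, hl⟩, ⟨_, hl'⟩,
        (h0.holds (by simpa using ha') (by simp [hl])).2 (by simp [ha]),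
        (h0.holds (by simpa using hb') (by simp [hl'])).2 (by simp [hb]),
        (h.holds (by simp [hl]) (by simp [hl'])).2 (by simpa [Function.update_apply] using h3), ?_⟩
      simp only [Function.update_apply, reduceCtorEq, if_false, if_true, h1, h2]
      cases c <;> simp
  rw [hstep _ (by simp) (by simp)]
  rcases wordAt_cases w a with ⟨c, h1, h2⟩ | ⟨h1, h2⟩ <;>
  rcases wordAt_cases w b with ⟨c', h3, h4⟩ | ⟨h3, h4⟩ <;>
  simp [h1, h2, h3, h4]
  grind

/-- After as many steps as there are positions, `same` relates exactly the positions that are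
followed by the same word, because every word is shorter than the input. -/
lemma reads_same (h0 : Reads w ρ .suc fun a b => b = a + 1) (h1 : Reads w ρ .nextSep (NextSep w))
    (h2 : ρ .same = []) :
    Reads w ((Cmd.rep .i (.assign .same .x .y sameFm)).exec w e ρ) .same
        (fun a b => wordAt w a = wordAt w b) ∧
      Reads w ((Cmd.rep .i (.assign .same .x .y sameFm)).exec w e ρ) .nextSep (NextSep w) := by
  have := exec_rep (w := w) (ρ := ρ) (e := e) (x := .i) (c := Cmd.assign .same .x .y sameFm)
    (fun m ρ => (Reads w ρ .suc fun a b => b = a + 1) ∧ Reads w ρ .nextSep (NextSep w) ∧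
      Reads w ρ .same fun a b => wordAt w a = wordAt w b ∧ (wordAt w a).length < m)
    ⟨h0, h1, fun a b => by simp [h2]⟩
    fun m e ρ h => ⟨reads_assign_of_ne (by simp) h.1, reads_assign_of_ne (by simp) h.2.1,
      reads_same_step h.1 h.2.2⟩
  refine ⟨fun a b => (this.2.2 a b).trans ?_, this.2.1⟩
  exact and_iff_left (length_wordAt_lt a.2)

lemma holds_pairFm (hs : Reads w ρ .same fun a b => wordAt w a = wordAt w b)
    (hn : Reads w ρ .nextSep (NextSep w)) {v : Var} (hv : v ≠ .q ∧ v ≠ .q₁)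
    (hp : e .p < w.length) (hv' : e v < w.length) : Holds w ρ e (pairFm v) ↔
      ∃ q, PairAt w .concept q (wordAt w (e .p)) (wordAt w (e v)) := by
  simp only [pairFm, holds_ex, holds_and, holds_sym]
  have hS : ∀ i k : Fin w.length, Holds w ρ (Function.update (Function.update e .q i) .q₁ k)
      (.rel .same .q .p) ↔ wordAt w i = wordAt w (e .p) := fun i k => by
    rw [hs.holds (by simp) (by simpa using hp)]; simp
  have hN : ∀ i k : Fin w.length, Holds w ρ (Function.update (Function.update e .q i) .q₁ k)
      (.rel .nextSep .q .q₁) ↔ NextSep w i k := fun i k => by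
    rw [hn.holds (by simp) (by simp)]; simp
  have hS' : ∀ i k : Fin w.length, Holds w ρ (Function.update (Function.update e .q i) .q₁ k)
      (.rel .same .q₁ v) ↔ wordAt w k = wordAt w (e v) := fun i k => by
    rw [hs.holds (by simp) (by simpa [hv] using hv')]; simp [hv]
  simp only [hS, hN, hS', Function.update_apply, reduceCtorEq, if_false, if_true]
  constructor
  · rintro ⟨q, q₁, h1, h2, h3, h4⟩
    exact ⟨q, h1, h2, q₁, h3, h4⟩
  · rintro ⟨q, h1, h2, q₁, h3, h4⟩
    exact ⟨⟨q, h3.1.trans h3.lt_length⟩, ⟨q₁, h3.lt_length⟩, h1, h2, h3, h4⟩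

lemma holds_tripleFm (hs : Reads w ρ .same fun a b => wordAt w a = wordAt w b)
    (hn : Reads w ρ .nextSep (NextSep w)) {s : Sym} {v v' : Var}
    (hv : v ≠ .q ∧ v ≠ .q₁ ∧ v ≠ .q₂) (hv' : v' ≠ .q ∧ v' ≠ .q₁ ∧ v' ≠ .q₂)
    (hp : e .p < w.length) (he : e v < w.length) (he' : e v' < w.length) :
    Holds w ρ e (tripleFm s v v') ↔
      ∃ q, TripleAt w s q (wordAt w (e .p)) (wordAt w (e v)) (wordAt w (e v')) := by
  simp only [tripleFm, holds_ex, holds_and, holds_sym]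
  have hS : ∀ i k l : Fin w.length, Holds w ρ
      (Function.update (Function.update (Function.update e .q i) .q₁ k) .q₂ l)
      (.rel .same .q .p) ↔ wordAt w i = wordAt w (e .p) := fun i k l => by
    rw [hs.holds (by simp) (by simpa using hp)]; simp
  have hN : ∀ i k l : Fin w.length, Holds w ρ
      (Function.update (Function.update (Function.update e .q i) .q₁ k) .q₂ l)
      (.rel .nextSep .q .q₁) ↔ NextSep w i k := fun i k l => by
    rw [hn.holds (by simp) (by simp)]; simp
  have hS' : ∀ i k l : Fin w.length, Holds w ρ
      (Function.update (Function.update (Function.update e .q i) .q₁ k) .q₂ l)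
      (.rel .same .q₁ v) ↔ wordAt w k = wordAt w (e v) := fun i k l => by
    rw [hs.holds (by simp) (by simpa [hv] using he)]; simp [hv]
  have hN' : ∀ i k l : Fin w.length, Holds w ρ
      (Function.update (Function.update (Function.update e .q i) .q₁ k) .q₂ l)
      (.rel .nextSep .q₁ .q₂) ↔ NextSep w k l := fun i k l => by
    rw [hn.holds (by simp) (by simp)]; simp
  have hS'' : ∀ i k l : Fin w.length, Holds w ρ
      (Function.update (Function.update (Function.update e .q i) .q₁ k) .q₂ l)
      (.rel .same .q₂ v') ↔ wordAt w l = wordAt w (e v') := fun i k l => by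
    rw [hs.holds (by simp) (by simpa [hv'] using he')]; simp [hv']
  simp only [hS, hN, hS', hN', hS'', Function.update_apply, reduceCtorEq, if_false, if_true]
  constructor
  · rintro ⟨q, q₁, q₂, h1, h2, h3, h4, h5, h6⟩
    exact ⟨q, h1, h2, q₁, h3, h4, q₂, h5, h6⟩
  · rintro ⟨q, h1, h2, q₁, h3, h4, q₂, h5, h6⟩
    exact ⟨⟨q, h3.1.trans h3.lt_length⟩, ⟨q₁, h3.lt_length⟩, ⟨q₂, h5.lt_length⟩,
      h1, h2, h3, h4, h5, h6⟩

lemma holds_firstFm (hs : Reads w ρ .same fun a b => wordAt w a = wordAt w b)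
    (hz : e .z < w.length) : Holds w ρ e firstFm ↔
      ∀ u : Fin w.length, wordAt w u = wordAt w (e .z) → e .z ≤ u := by
  simp only [firstFm, holds_all, holds_imp, holds_le, Function.update_apply, reduceCtorEq, if_false,
    if_true]
  refine forall_congr' fun u => ?_
  rw [hs.holds (by simp) (by simpa using hz)]
  simp

/-- Counting first occurrences of words amounts to counting words. -/
lemma ncard_first {T : Set Name} (hT : ∀ a ∈ T, ∃ p : Fin w.length, wordAt w p = a) :
    {z : Fin w.length | (∀ u : Fin w.length, wordAt w u = wordAt w z → (z : ℕ) ≤ u) ∧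
      wordAt w z ∈ T}.ncard = T.ncard := by
  refine Set.ncard_congr (fun z _ => wordAt w z) (fun z h => h.2) (fun z z' h h' e => ?_)
    fun a ha => ?_
  · exact Fin.ext (le_antisymm (h.1 z' e.symm) (h'.1 z e))
  · classical
    have hex : ∃ p, p < w.length ∧ wordAt w p = a := by
      obtain ⟨p, hp⟩ := hT a ha
      exact ⟨p, p.2, hp⟩
    refine ⟨⟨Nat.find hex, (Nat.find_spec hex).1⟩, ⟨fun u hu => ?_, ?_⟩, (Nat.find_spec hex).2⟩
    · exact Nat.find_min' hex ⟨u.2, hu.trans (Nat.find_spec hex).2⟩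
    · rw [(Nat.find_spec hex).2]
      exact ha

end Words

section Input

variable {𝔻 : FeatureDomains} {x : FittingInput 𝔻} {inv feat : Bool} {ρ : Rel → List Sym}
  {e : Var → ℕ}

lemma holds_conceptsFm (hs : Reads x.encode ρ .same fun a b => wordAt x.encode a = wordAt x.encode b)
    (hn : Reads x.encode ρ .nextSep (NextSep x.encode)) (hx : e .x < x.encode.length)
    (hy : e .y < x.encode.length) : Holds x.encode ρ e conceptsFm ↔ ∀ A,
      DBFact.concept A (wordAt x.encode (e .x)) ∈ x.I.facts ↔
        DBFact.concept A (wordAt x.encode (e .y)) ∈ x.I.facts := by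
  have key : Holds x.encode ρ e conceptsFm ↔ ∀ p : Fin x.encode.length,
      x.encode[(p : ℕ)]? = some .concept →
        (DBFact.concept (wordAt x.encode p) (wordAt x.encode (e .x)) ∈ x.I.facts ↔
          DBFact.concept (wordAt x.encode p) (wordAt x.encode (e .y)) ∈ x.I.facts) := by
    simp only [conceptsFm, holds_all, holds_imp, holds_iff, holds_sym, Function.update_self]
    refine forall_congr' fun p => imp_congr_right fun _ => ?_
    rw [holds_pairFm hs hn (by simp) (by simp) (by simpa using hx), x.exists_concept_iff,
      holds_pairFm hs hn (by simp) (by simp) (by simpa using hy), x.exists_concept_iff]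
    simp
  rw [key]
  refine ⟨fun H A => ⟨fun h => ?_, fun h => ?_⟩, fun H p _ => H _⟩
  · obtain ⟨p, h1, h2, q, h3, h4⟩ := x.exists_concept_iff.2 h
    rw [← h2] at h ⊢
    exact (H ⟨p, h3.1.trans h3.lt_length⟩ h1).1 h
  · obtain ⟨p, h1, h2, q, h3, h4⟩ := x.exists_concept_iff.2 h
    rw [← h2] at h ⊢
    exact (H ⟨p, h3.1.trans h3.lt_length⟩ h1).2 h

lemma holds_featuresFm
    (hs : Reads x.encode ρ .same fun a b => wordAt x.encode a = wordAt x.encode b)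
    (hn : Reads x.encode ρ .nextSep (NextSep x.encode)) (hx : e .x < x.encode.length)
    (hy : e .y < x.encode.length) : Holds x.encode ρ e featuresFm ↔ ∀ f v,
      DBFact.feature f (wordAt x.encode (e .x)) v ∈ x.I.facts ↔
        DBFact.feature f (wordAt x.encode (e .y)) v ∈ x.I.facts := by
  have key : Holds x.encode ρ e featuresFm ↔ ∀ p p₁ p₂ : Fin x.encode.length,
      x.encode[(p : ℕ)]? = some .feature → NextSep x.encode p p₁ → NextSep x.encode p₁ p₂ →
        ((∃ v, DBFact.feature (wordAt x.encode p) (wordAt x.encode (e .x)) v ∈ x.I.facts ∧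
          𝔻.code _ v = wordAt x.encode p₂) ↔
        ∃ v, DBFact.feature (wordAt x.encode p) (wordAt x.encode (e .y)) v ∈ x.I.facts ∧
          𝔻.code _ v = wordAt x.encode p₂) := by
    simp only [featuresFm, holds_all, holds_imp, holds_iff, holds_and, holds_sym, and_imp]
    refine forall_congr' fun p => forall_congr' fun p₁ => forall_congr' fun p₂ => ?_
    rw [hn.holds (by simp) (by simp), hn.holds (by simp) (by simp),
      holds_tripleFm hs hn (by simp) (by simp) (by simp) (by simpa using hx) (by simp),
      holds_tripleFm hs hn (by simp) (by simp) (by simp) (by simpa using hy) (by simp),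
      show Function.update (Function.update (Function.update e .p p) .p₁ p₁) .p₂ p₂ .p = (p : ℕ) by
        simp, x.exists_feature_iff, x.exists_feature_iff]
    simp only [Function.update_apply, reduceCtorEq, if_false, if_true]
  rw [key]
  have one : ∀ {a b : IndName}, (∀ p p₁ p₂ : Fin x.encode.length,
      x.encode[(p : ℕ)]? = some .feature → NextSep x.encode p p₁ → NextSep x.encode p₁ p₂ →
        (∃ v, DBFact.feature (wordAt x.encode p) a v ∈ x.I.facts ∧
          𝔻.code _ v = wordAt x.encode p₂) →
        ∃ v, DBFact.feature (wordAt x.encode p) b v ∈ x.I.facts ∧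
          𝔻.code _ v = wordAt x.encode p₂) → ∀ f v, DBFact.feature f a v ∈ x.I.facts →
        DBFact.feature f b v ∈ x.I.facts := by
    intro a b H f v h
    obtain ⟨p, h1, h2, q, h3, -, q', h5, h6⟩ := x.exists_feature_iff.2 ⟨v, h, rfl⟩
    subst h2
    obtain ⟨v', hv', he⟩ := H ⟨p, h3.1.trans h3.lt_length⟩ ⟨q, h3.lt_length⟩ ⟨q', h5.lt_length⟩
      h1 h3 h5 ⟨v, h, h6.symm⟩
    -- this is where distinct values need distinct codes
    rwa [← 𝔻.code_injOn _ (x.writable _ _ _ hv') (x.writable _ _ _ h) (he.trans h6)]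
  refine ⟨fun H f v => ⟨one (fun p p₁ p₂ h1 h2 h3 => (H p p₁ p₂ h1 h2 h3).1) f v,
    one (fun p p₁ p₂ h1 h2 h3 => (H p p₁ p₂ h1 h2 h3).2) f v⟩, fun H p p₁ p₂ _ _ _ => ?_⟩
  simp only [H]

lemma reads_simZero (hs : Reads x.encode ρ .same fun a b => wordAt x.encode a = wordAt x.encode b)
    (hn : Reads x.encode ρ .nextSep (NextSep x.encode)) :
    Reads x.encode ((Cmd.assign .sim .x .y (simZeroFm feat)).exec x.encode e ρ) .sim
      fun a b => Sim x.I inv feat 0 (wordAt x.encode a) (wordAt x.encode b) := by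
  refine reads_assign_self fun a b => ?_
  cases feat
  · simp only [simZeroFm, Bool.false_eq_true, if_false]
    rw [holds_conceptsFm hs hn (by simp) (by simp)]
    simp [Sim]
  · simp only [simZeroFm, if_true, holds_and]
    rw [holds_conceptsFm hs hn (by simp) (by simp), holds_featuresFm hs hn (by simp) (by simp)]
    simp [Sim]

/-- A role name that does not occur in the input does not distinguish any individuals, so it
suffices to consider the role names that occur. -/
lemma forall_role_iff {D : Set IndName} (F : RoleName → Role) (hF : F = .name ∨ F = .inv)
    {i : ℕ} {a b : IndName} :
    (∀ r, ∀ c ∈ D, (x.I.succ (F r) a ∩ {z | Sim x.I inv feat i z c}).ncard =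
        (x.I.succ (F r) b ∩ {z | Sim x.I inv feat i z c}).ncard) ↔
      ∀ p : Fin x.encode.length, ∀ c ∈ D, x.encode[(p : ℕ)]? = some .role →
        (x.I.succ (F (wordAt x.encode p)) a ∩ {z | Sim x.I inv feat i z c}).ncard =
        (x.I.succ (F (wordAt x.encode p)) b ∩ {z | Sim x.I inv feat i z c}).ncard := by
  refine ⟨fun H p c hc _ => H _ c hc, fun H r c hc => ?_⟩
  by_cases hr : ∃ a b, DBFact.role r a b ∈ x.I.facts
  · obtain ⟨a, b, h⟩ := hr
    obtain ⟨p, h1, rfl, q, h3, -⟩ := x.exists_role_iff.2 h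
    exact H ⟨p, h3.1.trans h3.lt_length⟩ c hc h1
  · have : ∀ a, x.I.succ (F r) a = ∅ := by
      intro a
      refine Set.eq_empty_iff_forall_notMem.2 fun b hb => hr ?_
      rcases hF with rfl | rfl
      exacts [⟨_, _, hb⟩, ⟨_, _, hb⟩]
    rw [this, this]

/-- The number of the positions that satisfy the formulas in `succFm` and `predFm`. -/
lemma ncard_holds_class
    (hs : Reads x.encode ρ .same fun a b => wordAt x.encode a = wordAt x.encode b) {i : ℕ}
    (hsim : Reads x.encode ρ .sim
      fun a b => Sim x.I inv feat i (wordAt x.encode a) (wordAt x.encode b))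
    (hc : e .c < x.encode.length) {ψ : Fm Var Rel} {R : Role} {a : IndName}
    (hψ : ∀ z : Fin x.encode.length, Holds x.encode ρ (Function.update e .z z) ψ ↔
      wordAt x.encode z ∈ x.I.succ R a) :
    {z : Fin x.encode.length | Holds x.encode ρ (Function.update e .z z)
      (.and firstFm (.and ψ (.rel .sim .z .c)))}.ncard =
      (x.I.succ R a ∩ {z | Sim x.I inv feat i z (wordAt x.encode (e .c))}).ncard := by
  rw [← ncard_first (w := x.encode) fun a ha => x.exists_wordAt_eq (x.I.succ_subset_adom _ _ ha.1)]
  congr 1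
  ext z
  simp only [Set.mem_ofPred_eq, holds_and, Set.mem_inter_iff]
  rw [hψ, holds_firstFm hs (by simp), hsim.holds (by simp) (by simpa using hc)]
  simp

lemma holds_succFm (hs : Reads x.encode ρ .same fun a b => wordAt x.encode a = wordAt x.encode b)
    (hn : Reads x.encode ρ .nextSep (NextSep x.encode)) {i : ℕ}
    (hsim : Reads x.encode ρ .sim
      fun a b => Sim x.I inv feat i (wordAt x.encode a) (wordAt x.encode b))
    (hx : e .x < x.encode.length) (hy : e .y < x.encode.length) :
    Holds x.encode ρ e succFm ↔ ∀ r, ∀ c ∈ Set.range fun p : Fin x.encode.length =>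
      wordAt x.encode p, (x.I.succ (.name r) (wordAt x.encode (e .x)) ∩
        {z | Sim x.I inv feat i z c}).ncard =
      (x.I.succ (.name r) (wordAt x.encode (e .y)) ∩ {z | Sim x.I inv feat i z c}).ncard := by
  rw [forall_role_iff _ (Or.inl rfl)]
  simp only [succFm, holds_all, holds_imp, holds_sym, holds_ceq, Set.forall_mem_range]
  refine forall_congr' fun p => forall_congr' fun c => ?_
  have key : ∀ v, v = .x ∨ v = .y → e v < x.encode.length → ∀ z : Fin x.encode.length,
      Holds x.encode ρ (Function.update (Function.update (Function.update e .p p) .c c) .z z)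
        (tripleFm .role v .z) ↔
        wordAt x.encode z ∈ x.I.succ (.name (wordAt x.encode p)) (wordAt x.encode (e v)) := by
    rintro v hv hlt z
    rw [holds_tripleFm hs hn (by rcases hv with rfl | rfl <;> simp) (by simp) (by simp)
      (by rcases hv with rfl | rfl <;> simpa using hlt) (by simp), x.exists_role_iff]
    rcases hv with rfl | rfl <;> simp [Database.succ]
  rw [ncard_holds_class hs hsim (by simp) (key .x (Or.inl rfl) hx),
    ncard_holds_class hs hsim (by simp) (key .y (Or.inr rfl) hy)]
  simp only [Function.update_apply, reduceCtorEq, if_false, if_true]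

lemma holds_predFm (hs : Reads x.encode ρ .same fun a b => wordAt x.encode a = wordAt x.encode b)
    (hn : Reads x.encode ρ .nextSep (NextSep x.encode)) {i : ℕ}
    (hsim : Reads x.encode ρ .sim
      fun a b => Sim x.I inv feat i (wordAt x.encode a) (wordAt x.encode b))
    (hx : e .x < x.encode.length) (hy : e .y < x.encode.length) :
    Holds x.encode ρ e predFm ↔ ∀ r, ∀ c ∈ Set.range fun p : Fin x.encode.length =>
      wordAt x.encode p, (x.I.succ (.inv r) (wordAt x.encode (e .x)) ∩
        {z | Sim x.I inv feat i z c}).ncard =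
      (x.I.succ (.inv r) (wordAt x.encode (e .y)) ∩ {z | Sim x.I inv feat i z c}).ncard := by
  rw [forall_role_iff _ (Or.inr rfl)]
  simp only [predFm, holds_all, holds_imp, holds_sym, holds_ceq, Set.forall_mem_range]
  refine forall_congr' fun p => forall_congr' fun c => ?_
  have key : ∀ v, v = .x ∨ v = .y → e v < x.encode.length → ∀ z : Fin x.encode.length,
      Holds x.encode ρ (Function.update (Function.update (Function.update e .p p) .c c) .z z)
        (tripleFm .role .z v) ↔
        wordAt x.encode z ∈ x.I.succ (.inv (wordAt x.encode p)) (wordAt x.encode (e v)) := by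
    rintro v hv hlt z
    rw [holds_tripleFm hs hn (by simp) (by rcases hv with rfl | rfl <;> simp) (by simp) (by simp)
      (by rcases hv with rfl | rfl <;> simpa using hlt), x.exists_role_iff]
    rcases hv with rfl | rfl <;> simp [Database.succ]
  rw [ncard_holds_class hs hsim (by simp) (key .x (Or.inl rfl) hx),
    ncard_holds_class hs hsim (by simp) (key .y (Or.inr rfl) hy)]
  simp only [Function.update_apply, reduceCtorEq, if_false, if_true]

lemma reads_simSucc (hs : Reads x.encode ρ .same fun a b => wordAt x.encode a = wordAt x.encode b)
    (hn : Reads x.encode ρ .nextSep (NextSep x.encode)) {i : ℕ}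
    (hsim : Reads x.encode ρ .sim
      fun a b => Sim x.I inv feat i (wordAt x.encode a) (wordAt x.encode b)) :
    Reads x.encode ((Cmd.assign .sim .x .y (simSuccFm inv)).exec x.encode e ρ) .sim
      fun a b => Sim x.I inv feat (i + 1) (wordAt x.encode a) (wordAt x.encode b) := by
  refine reads_assign_self fun a b => ?_
  rw [sim_succ_iff (D := Set.range fun p : Fin x.encode.length => wordAt x.encode p)
    fun a ha => x.exists_wordAt_eq ha]
  simp only [simSuccFm, holds_and]
  rw [hsim.holds (by simp) (by simp)]
  have hroles : ∀ F : Role → Prop, (∀ R, R.Allowed inv → F R) ↔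
      (∀ r, F (.name r)) ∧ (inv = true → ∀ r, F (.inv r)) := by
    refine fun F => ⟨fun h => ⟨fun r => h _ trivial, fun hi r => h _ hi⟩, fun h R hR => ?_⟩
    cases R
    exacts [h.1 _, h.2 hR _]
  rw [hroles]
  cases inv
  · simp only [Bool.false_eq_true, if_false, false_imp_iff, and_true]
    rw [holds_succFm hs hn hsim (by simp) (by simp)]
    simp only [Function.update_apply, reduceCtorEq, if_false, if_true]
  · simp only [if_true, holds_and, true_imp_iff]
    rw [holds_succFm hs hn hsim (by simp) (by simp), holds_predFm hs hn hsim (by simp) (by simp)]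
    simp only [Function.update_apply, reduceCtorEq, if_false, if_true]

/-- In the end, `sim` is the stage `|w| * |w|` of `Sim`, where the outer loop counts the multiples of
`|w|`. -/
lemma reads_cmd (h : ρ .same = []) : Reads x.encode ((cmd inv feat).exec x.encode e ρ) .sim
    fun a b => Sim x.I inv feat (x.encode.length * x.encode.length) (wordAt x.encode a)
      (wordAt x.encode b) := by
  have h1 := reads_suc (w := x.encode) (e := e) (ρ := ρ)
  have h2 := reads_nextSep (w := x.encode) (e := e)
    (ρ := (Cmd.assign .suc .x .y sucFm).exec x.encode e ρ)
  have h3 := reads_assign_of_ne (w := x.encode) (x := Var.x) (y := .y) (φ := nextSepFm) (e := e)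
    (j := Rel.nextSep) (by simp) h1
  obtain ⟨h4, h5⟩ := reads_same (e := e) h3 h2 (by simp [Cmd.exec, h])
  have h6 := reads_simZero (e := e) (inv := inv) (feat := feat) h4 h5
  have h7 := reads_assign_of_ne (w := x.encode) (x := Var.x) (y := .y) (φ := simZeroFm feat)
    (e := e) (j := Rel.sim) (by simp) h4
  have h8 := reads_assign_of_ne (w := x.encode) (x := Var.x) (y := .y) (φ := simZeroFm feat)
    (e := e) (j := Rel.sim) (by simp) h5
  have step : ∀ m e ρ, (Reads x.encode ρ .same (fun a b => wordAt x.encode a = wordAt x.encode b) ∧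
      Reads x.encode ρ .nextSep (NextSep x.encode) ∧ Reads x.encode ρ .sim
        fun a b => Sim x.I inv feat m (wordAt x.encode a) (wordAt x.encode b)) →
      (Reads x.encode ((Cmd.assign .sim .x .y (simSuccFm inv)).exec x.encode e ρ) .same
        (fun a b => wordAt x.encode a = wordAt x.encode b) ∧
      Reads x.encode ((Cmd.assign .sim .x .y (simSuccFm inv)).exec x.encode e ρ) .nextSep
        (NextSep x.encode) ∧
      Reads x.encode ((Cmd.assign .sim .x .y (simSuccFm inv)).exec x.encode e ρ) .sim
        fun a b => Sim x.I inv feat (m + 1) (wordAt x.encode a) (wordAt x.encode b)) :=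
    fun m e ρ H => ⟨reads_assign_of_ne (by simp) H.1, reads_assign_of_ne (by simp) H.2.1,
      reads_simSucc H.1 H.2.1 H.2.2⟩
  refine (exec_rep (c := .rep .k (.assign .sim .x .y (simSuccFm inv))) (fun m ρ =>
    Reads x.encode ρ .same (fun a b => wordAt x.encode a = wordAt x.encode b) ∧
      Reads x.encode ρ .nextSep (NextSep x.encode) ∧ Reads x.encode ρ .sim
        fun a b => Sim x.I inv feat (m * x.encode.length) (wordAt x.encode a)
          (wordAt x.encode b)) ⟨h7, h8, by simpa using h6⟩ fun m e ρ H => ?_).2.2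
  rw [Nat.succ_mul]
  exact exec_rep (fun k ρ =>
    Reads x.encode ρ .same (fun a b => wordAt x.encode a = wordAt x.encode b) ∧
      Reads x.encode ρ .nextSep (NextSep x.encode) ∧ Reads x.encode ρ .sim
        fun a b => Sim x.I inv feat (m * x.encode.length + k) (wordAt x.encode a)
          (wordAt x.encode b)) H fun k e ρ H => step _ e ρ H

lemma ncard_adom_le (x : FittingInput 𝔻) : x.I.adom.ncard ≤ x.encode.length := by
  have h : x.I.adom ⊆ Set.range fun p : Fin x.encode.length => wordAt x.encode p :=
    fun a ha => x.exists_wordAt_eq ha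
  refine (Set.ncard_le_ncard h (Set.finite_range _)).trans ?_
  rw [← Set.image_univ]
  refine (Set.ncard_image_le Set.finite_univ).trans ?_
  simp [Set.ncard_univ]

/-- The decision procedure is correct. -/
theorem holds_answerFm_iff :
    Holds x.encode ((cmd inv feat).exec x.encode (fun _ => 0) fun _ => []) (fun _ => 0) answerFm ↔
      HasFitting (Logic 𝔻 inv feat) x := by
  have h := reads_cmd (x := x) (inv := inv) (feat := feat) (e := fun _ => 0) (ρ := fun _ => []) rfl
  rw [hasFitting_iff]
  simp only [answerFm, holds_all, holds_imp, holds_and, holds_not, holds_sym]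
  have key : (∀ p q : Fin x.encode.length, x.encode[(p : ℕ)]? = some .pos ∧
      x.encode[(q : ℕ)]? = some .neg → ¬ Sim x.I inv feat (x.encode.length * x.encode.length)
        (wordAt x.encode p) (wordAt x.encode q)) ↔
      ∀ a ∈ x.P, ∀ b ∈ x.N, ¬ Indist x.I inv feat a b := by
    have hm := Nat.mul_le_mul (ncard_adom_le x) (ncard_adom_le x)
    constructor
    · intro H a ha b hb hab
      obtain ⟨p, hp, rfl⟩ := x.exists_example_iff.1.2 ha
      obtain ⟨q, hq, rfl⟩ := x.exists_example_iff.2.2 hb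
      exact H ⟨p, (List.getElem?_eq_some_iff.1 hp).1⟩ ⟨q, (List.getElem?_eq_some_iff.1 hq).1⟩
        ⟨hp, hq⟩ ((indist_iff_sim hm (x.P_subset _ ha) (x.N_subset _ hb)).1 hab)
    · rintro H p q ⟨hp, hq⟩ hpq
      have ha := x.exists_example_iff.1.1 ⟨p, hp, rfl⟩
      have hb := x.exists_example_iff.2.1 ⟨q, hq, rfl⟩
      exact H _ ha _ hb ((indist_iff_sim hm (x.P_subset _ ha) (x.N_subset _ hb)).2 hpq)
  rw [← key]
  refine forall_congr' fun p => forall_congr' fun q => ?_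
  rw [h.holds (by simp) (by simp)]
  simp only [Function.update_apply, reduceCtorEq, if_false, if_true]

end Input

end Procedure

theorem decidableInPolyTime_hasFitting_logic (𝔻 : FeatureDomains) (inv feat : Bool) :
    DecidableInPolyTime FittingInput.encode (HasFitting (Logic 𝔻 inv feat)) :=
  decidableInPolyTime_of_holds _ _ (Procedure.cmd inv feat) Procedure.answerFm
    (Procedure.proper_cmd inv feat) Procedure.proper_answerFm fun _ => Procedure.holds_answerFm_iff

end DL

theorem theorem1 (𝔻 : DL.FeatureDomains) :
    DL.DecidableInPolyTime DL.FittingInput.encode (DL.HasFitting (DL.ALCQIf 𝔻)) ∧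
    DL.DecidableInPolyTime DL.FittingInput.encode (DL.HasFitting (DL.ALCQf 𝔻)) ∧
    DL.DecidableInPolyTime DL.FittingInput.encode (DL.HasFitting (DL.ALCQI 𝔻)) ∧
    DL.DecidableInPolyTime DL.FittingInput.encode (DL.HasFitting (DL.ALCQ 𝔻)) := by
  have h := DL.decidableInPolyTime_hasFitting_logic 𝔻
  rw [show DL.ALCQIf 𝔻 = DL.Logic 𝔻 true true by ext; simp [DL.ALCQIf, DL.Logic],
    show DL.ALCQf 𝔻 = DL.Logic 𝔻 false true by ext; simp [DL.ALCQf, DL.Logic],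
    show DL.ALCQI 𝔻 = DL.Logic 𝔻 true false by ext; simp [DL.ALCQI, DL.Logic],
    show DL.ALCQ 𝔻 = DL.Logic 𝔻 false false by ext; simp [DL.ALCQ, DL.Logic]]
  exact ⟨h true true, h false true, h true false, h false false⟩
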